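/- **Conventions.** A p.p.t. adversary is a pair $(\overline G,q)$, where $q$ is a polynomial with natural number coefficients and $\overline G(1^n,y,r)$, for $n\in\mathbb N$ and $y,r\in\{0,1\}^*$, is a partial function with values in $\{0,1\}^*$ that is computable by a Turing machine (which reports when the function is undefined) in time polynomial in the length of the input; $q(n)$ is the number of random bits used. For $F:\{0,1\}^*\to\{0,1\}^*$ let $\overline F(x)=(1^{|x|},F(x))$, and let $$\mathbb P^n\{\overline F\circ\overline G=I\}=\Pr\big[\,\overline G(1^n,F(X),R)\text{ is defined and }\overline F(\overline G(1^n,F(X),R))=(1^n,F(X))\,\big],$$ where $X\in\{0,1\}^n$ and $R\in\{0,1\}^{q(n)}$ are independent and uniformly distributed. "Almost always" (a.a.) means "for all sufficiently large $n$". A polynomial time computable function $F:\{0,1\}^*\to\{0,1\}^*$ is *strongly one-way* if for all real $d>0$ and all p.p.t. $\overline G$, $\mathbb P^n\{\overline F\circ\overline G=I\}\le n^{-d}$ a.a. **Direct power.** Let $t:\mathbb N\to\mathbb N$ with $t(n)>0$ for $n>0$. For a string $x=x_0x_1\cdots x_{t(n)-1}$ with $|x_i|=n$ for all $i$, put $F'(x)=(F(x_0),F(x_1),\ldots,F(x_{t(n)-1}))$,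 where a tuple of strings is written as one string by replacing each entry $b_1\cdots b_l$ by the self-delimiting word $1b_1\,1b_2\cdots 1b_l\,0$ and concatenating. The function $F'$ is made total as follows: for an arbitrary string $x$, let $n$ be the largest integer with $n\,t(n)\le |x|$, write $x=x'z$ with $|x'|=n\,t(n)$, and let $F'(x)$ be the concatenation of the direct power's value at $x'$ with $z$. **Theorem.** Let $F:\{0,1\}^*\to\{0,1\}^*$ be a weakly one-way function, so that $F$ is computable in polynomial time and, for some integer $c>0$, $$(\forall\,\text{p.p.t. }\overline G)\quad \big(\mathbb P^n\{\overline F\circ\overline G=I\}\le 1-n^{-c}\ \text{ a.a.}\big).$$ Then $F'$, defined as above with $t(n)=n^{c+1}$, is a strongly one-way function; in particular, $F'$ is computable in polynomial time. -/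

import Mathlib

namespace OneWay

/-! ### Polynomial time

Bit strings are `List Bool`. The machine model and its step count are Mathlib's multi-stack Turing
machines `Turing.FinTM2`. -/

/-- `F : {0,1}* → {0,1}*` is computed by a Turing machine within a number of steps that is
polynomial in the length of the input. -/
def PolyTimeComputable (F : List Bool → List Bool) : Prop :=
  Nonempty (Turing.TM2ComputableInPolyTime (id : List Bool → List Bool) id F)

/-- The word `1ⁿ # y # r` that presents `(1ⁿ, y, r)` to a machine (`none` is the separator). The
number `n` is written in unary. -/
def encodeTriple (a : ℕ × List Bool × List Bool) : List (Option Bool) :=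
  List.replicate a.1 (some true) ++ [none] ++ a.2.1.map some ++ [none] ++ a.2.2.map some

/-- The word by which a machine reports the value of a partial function: the empty word if the
function is undefined, and `1x` if its value is `x`. -/
def encodePartial : Option (List Bool) → List Bool
  | none => []
  | some x => true :: x

/-- A probabilistic polynomial time adversary: a partial function `G(1ⁿ, y, r)` (undefined means
`none`) that is computable in polynomial time, together with the polynomial `q` that gives the
number `q(n)` of random bits `r` it receives. As `|r| = q(n)`, polynomial time in `|(1ⁿ, y, r)|` is
polynomial time in `|(1ⁿ, y)|`. -/
structure PPT where
  /-- the partial function; its arguments are `n` (that is, `1ⁿ`), `y` and `r` -/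
  G : ℕ × List Bool × List Bool → Option (List Bool)
  /-- the number of random bits -/
  q : Polynomial ℕ
  polyTime : Nonempty (Turing.TM2ComputableInPolyTime encodeTriple encodePartial G)

/-! ### Inversion probability and one-way functions -/

/-- The auxiliary function `x ↦ (1^|x|, F(x))`. -/
def aux (F : List Bool → List Bool) (x : List Bool) : ℕ × List Bool := (x.length, F x)

/-- The probability that `aux F (G (1ⁿ, Y, R)) = (1ⁿ, Y)`, where `Y = F(X)`, and `X ∈ {0,1}ⁿ` and
`R ∈ {0,1}^q(n)` are independent and uniformly distributed. -/
noncomputable def invertProb (F : List Bool → List Bool) (A : PPT) (n : ℕ) : ℝ :=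
  (Fintype.card {p : List.Vector Bool n × List.Vector Bool (A.q.eval n) //
    (A.G (n, F p.1.toList, p.2.toList)).map (aux F) = some (n, F p.1.toList)} : ℝ) /
  (Fintype.card (List.Vector Bool n × List.Vector Bool (A.q.eval n)) : ℝ)

/-- `p(n) = n^{-ω(1)}`. -/
def Negligible (p : ℕ → ℝ) : Prop :=
  ∀ d : ℝ, 0 < d → ∀ᶠ n : ℕ in Filter.atTop, p n ≤ (n : ℝ) ^ (-d)

/-- `F` is computable in polynomial time, and every p.p.t. adversary inverts it with negligible
probability only. -/
def StronglyOneWay (F : List Bool → List Bool) : Prop :=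
  PolyTimeComputable F ∧ ∀ A : PPT, Negligible (invertProb F A)

/-- `F` is computable in polynomial time, and every p.p.t. adversary inverts it, for all large `n`
(how large may depend on the adversary), with probability at most `1 - n^{-c}`. -/
def WeaklyOneWayWith (c : ℕ) (F : List Bool → List Bool) : Prop :=
  PolyTimeComputable F ∧
    ∀ A : PPT, ∀ᶠ n : ℕ in Filter.atTop, invertProb F A n ≤ 1 - 1 / (n : ℝ) ^ c

/-! ### Direct powers -/

/-- A self-delimiting code of a bit string: `b₁ b₂ ⋯ b_l ↦ 1 b₁ 1 b₂ ⋯ 1 b_l 0`. -/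
def encodeBlock (y : List Bool) : List Bool := y.flatMap (fun b => [true, b]) ++ [false]

/-- A tuple of bit strings (of arbitrary lengths) as one bit string. -/
def encodeTuple (ys : List (List Bool)) : List Bool := ys.flatMap encodeBlock

/-- `(F(x₀), …, F(x_{t-1}))` for `x = x₀ x₁ ⋯ x_{t-1}` with `|x_i| = n`. -/
def powerBlocks (F : List Bool → List Bool) (n t : ℕ) (x : List Bool) : List Bool :=
  encodeTuple ((List.range t).map fun i => F ((x.drop (i * n)).take n))

/-- The largest `n` with `n * t n ≤ N` (for `t n` positive at `n > 0`, such an `n` is at most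
`N`). -/
def blockLength (t : ℕ → ℕ) (N : ℕ) : ℕ := Nat.findGreatest (fun n => n * t n ≤ N) N

/-- The direct power of `F`, as a total function: `x` is split as `x' z`, where `|x'| = n * t n` for
the largest possible `n`; the direct power is applied to `x'`, and `z` is appended unchanged. -/
def directPower (F : List Bool → List Bool) (t : ℕ → ℕ) (x : List Bool) : List Bool :=
  let n := blockLength t x.length
  powerBlocks F n (t n) (x.take (n * t n)) ++ x.drop (n * t n)

end OneWay

/-!
# Direct powers of weakly one-way functions are strongly one-way

Let `t = n ^ (c + 1)` and suppose that an adversary `A` inverts the direct power `F'` on inputs of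
some length `N` with probability more than `ε = N ^ (-d)`, where `n` is the block length belonging
to `N`. Call `x` of length `n` *bad* if for every position `i < t` the probability that `A` succeeds
on a random input whose `i`-th block is `x` is at most `ε / (2t)`. A successful run either has a bad
block, which costs at most `t * ε / (2t) = ε / 2`, or has no bad block, which has probability
`(1 - β) ^ t` for the fraction `β` of bad strings (`invertProb_le`). As `t = n * n ^ c`, a value
`β ≥ 1 / (2 n ^ c)` would make the second term exponentially small; so `β < 1 / (2 n ^ c)`.

The adversary against `F` (`preimages`) is given `y = F(x)`. It cuts its random bits into
polynomially many chunks and, with every chunk, for every `N` that is not too large and every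
position `i`, builds a random image under `F'` whose `i`-th component is replaced by `y`, runs `A`
on it, and tests whether the `i`-th block of the answer is a preimage of `y`. The true `N` is
unknown to the adversary, and trying all of them with the same chunk does no harm, because answers
are tested. For an `x` that is not bad, some fixed `i` succeeds with each of the independent chunks
with probability more than `ε / (2t)`, so that all of them fail with exponentially small probability
(`le_invertProb`). Altogether `F` is inverted with probability more than `1 - n ^ (-c)`, for
infinitely many `n`.

That `F'` and the adversary are computable in polynomial time is shown with a small programming
language. `Prog` is a language of structured programs over stacks that can call given machines, and
`steps_code` compiles it to Mathlib's `TM2` model. `PolyFun O v f` says that a program computes `f`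
in polynomial time from the variables `v`; this notion is closed under concatenation, case
distinction, calls, and the bounded loop `(List.range n).flatMap h` (`PolyFun.flatMap`). The loop is
strong enough to express everything that is needed, with numbers written in unary.

Probabilities are handled through `avg n f`, the average of `f` over the bit strings of length `n`,
whose recursive definition makes Fubini's theorem and the independence of disjoint blocks of a
random string short inductions.
-/

namespace OneWay

open Turing Function StateTransition

/-! ### Structured programs over stacks -/

/-- The alphabet of the stacks that programs work on: bits and one separator `none`. -/
abbrev Sym := Option Bool

/-- A machine that programs can call, with translations between its input and output alphabets
and `Sym`. -/
structure Oracle where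
  M : FinTM2
  dec : Sym → M.Γ M.k₀
  enc : M.Γ M.k₁ → Sym

/-- Structured programs over stacks of symbols, which are named by natural numbers. `case k P` pops
stack `k` and runs `P` on the result (`none` if the stack is empty); `loop k P` pops stack `k` and
runs `P` on the symbol, until the stack is empty; `call j i o` runs machine `j` on the content of
stack `i` and writes its output to stack `o`. -/
inductive Prog (J : Type) where
  | skip : Prog J
  | push (k : ℕ) (a : Sym) : Prog J
  | seq (P Q : Prog J) : Prog J
  | case (k : ℕ) (P : Option Sym → Prog J) : Prog J
  | loop (k : ℕ) (P : Sym → Prog J) : Prog J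
  | call (j : J) (i o : ℕ) : Prog J

/-- Big-step semantics: `Exec O P S S' t` says that `P` turns the stacks `S` into `S'` in `t` steps.
A word that is written from left to right ends up reversed on a stack; accordingly, a call expects
its input reversed, empties the input stack, and leaves its output reversed on top of `o`. -/
inductive Exec {J : Type} (O : J → Oracle) :
    Prog J → (ℕ → List Sym) → (ℕ → List Sym) → ℕ → Prop
  | skip (S) : Exec O .skip S S 1
  | push (S k a) : Exec O (.push k a) S (update S k (a :: S k)) 1
  | seq {P Q S S' S'' t t'} : Exec O P S S' t → Exec O Q S' S'' t' →
      Exec O (.seq P Q) S S'' (t + t')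
  | case {k P S S' t} : Exec O (P (S k).head?) (update S k (S k).tail) S' t →
      Exec O (.case k P) S S' (t + 1)
  | loop_nil {k P S} : S k = [] → Exec O (.loop k P) S S 1
  | loop_cons {k P S S' S'' t t' a l} : S k = a :: l → Exec O (P a) (update S k l) S' t →
      Exec O (.loop k P) S' S'' t' → Exec O (.loop k P) S S'' (t + t' + 1)
  | call {j i o S} {w : List Sym} {w' : List ((O j).M.Γ (O j).M.k₁)} {T} :
      TM2OutputsInTime (O j).M (w.map (O j).dec) (some w') T →
      S i = w.reverse →
      Exec O (.call j i o) S
        (update (update S i []) o ((w'.map (O j).enc).reverse ++ update S i [] o))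
        (w.length + T + w'.length + 2)

variable {J : Type} {O : J → Oracle}

variable (O) in
/-- `P` turns the stacks `S` into `S'` in at most `T` steps. -/
def Runs (P : Prog J) (S S' : ℕ → List Sym) (T : ℕ) : Prop := ∃ t ≤ T, Exec O P S S' t

theorem Runs.mono {P : Prog J} {S S' : ℕ → List Sym} {T T' : ℕ} (h : Runs O P S S' T)
    (hT : T ≤ T') : Runs O P S S' T' := by
  obtain ⟨t, ht, h⟩ := h
  exact ⟨t, ht.trans hT, h⟩

theorem Runs.conv {P : Prog J} {S S' S'' : ℕ → List Sym} {T T' : ℕ} (h : Runs O P S S' T)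
    (hS : ∀ k, S'' k = S' k) (hT : T ≤ T') : Runs O P S S'' T' := by
  rw [funext hS]
  exact h.mono hT

theorem Runs.seq {P Q : Prog J} {S S' S'' : ℕ → List Sym} {T T' : ℕ} (h : Runs O P S S' T)
    (h' : Runs O Q S' S'' T') : Runs O (.seq P Q) S S'' (T + T') := by
  obtain ⟨t, ht, h⟩ := h
  obtain ⟨t', ht', h'⟩ := h'
  exact ⟨_, add_le_add ht ht', .seq h h'⟩

theorem Runs.skip (S : ℕ → List Sym) : Runs O .skip S S 1 := ⟨1, le_rfl, .skip S⟩

theorem Runs.push (S : ℕ → List Sym) (k : ℕ) (a : Sym) :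
    Runs O (.push k a) S (update S k (a :: S k)) 1 := ⟨1, le_rfl, .push S k a⟩

theorem Runs.case {k : ℕ} {P : Option Sym → Prog J} {S S' : ℕ → List Sym} {T : ℕ}
    (h : Runs O (P (S k).head?) (update S k (S k).tail) S' T) :
    Runs O (.case k P) S S' (T + 1) := by
  obtain ⟨t, ht, h⟩ := h
  exact ⟨_, by omega, .case h⟩

theorem Runs.loop_nil {k : ℕ} {P : Sym → Prog J} {S : ℕ → List Sym} (h : S k = []) :
    Runs O (.loop k P) S S 1 := ⟨1, le_rfl, .loop_nil h⟩

theorem Runs.loop_cons {k : ℕ} {P : Sym → Prog J} {S S' S'' : ℕ → List Sym} {T T' : ℕ}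
    {a : Sym} {l : List Sym} (hk : S k = a :: l) (h : Runs O (P a) (update S k l) S' T)
    (h' : Runs O (.loop k P) S' S'' T') : Runs O (.loop k P) S S'' (T + T' + 1) := by
  obtain ⟨t, ht, h⟩ := h
  obtain ⟨t', ht', h'⟩ := h'
  exact ⟨_, by omega, .loop_cons hk h h'⟩

theorem Runs.clear (k : ℕ) (S : ℕ → List Sym) :
    Runs O (.loop k fun _ => .skip) S (update S k []) (2 * (S k).length + 1) := by
  generalize hl : S k = l
  induction l generalizing S with
  | nil =>
    have : update S k [] = S := by rw [← hl, update_eq_self]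
    rw [this]
    exact .loop_nil hl
  | cons a l ih =>
    have := ih (update S k l) (by simp)
    rw [update_idem] at this
    exact (Runs.loop_cons hl (.skip _) this).mono (by simp; omega)

theorem Runs.move {k x : ℕ} (hx : k ≠ x) (S : ℕ → List Sym) :
    Runs O (.loop k fun a => .push x a) S
      (update (update S k []) x ((S k).reverse ++ S x)) (2 * (S k).length + 1) := by
  generalize hl : S k = l
  induction l generalizing S with
  | nil =>
    refine (Runs.loop_nil hl).conv (fun i => ?_) le_rfl
    simp only [update_apply]
    split_ifs <;> simp_all
  | cons a l ih =>
    have := ih (update (update S k l) x (a :: S x)) (by simp [hx])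
    rw [show a :: S x = a :: update S k l x by simp [hx.symm]] at this
    refine (Runs.loop_cons hl (.push _ _ _) this).conv (fun i => ?_) (by simp; omega)
    simp only [update_apply]
    split_ifs <;> simp_all

theorem Runs.move_two {k x y : ℕ} (hx : k ≠ x) (hy : k ≠ y) (hxy : x ≠ y) (S : ℕ → List Sym) :
    Runs O (.loop k fun a => .seq (.push x a) (.push y a)) S
      (update (update (update S k []) x ((S k).reverse ++ S x)) y ((S k).reverse ++ S y))
      (3 * (S k).length + 1) := by
  generalize hl : S k = l
  induction l generalizing S with
  | nil =>
    refine (Runs.loop_nil hl).conv (fun i => ?_) le_rfl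
    simp only [update_apply]
    split_ifs <;> simp_all
  | cons a l ih =>
    refine (Runs.loop_cons hl ((Runs.push _ _ _).seq (.push _ _ _))
      (ih _ (by simp [hx, hy]))).conv (fun i => ?_) (by simp; omega)
    simp only [update_apply]
    split_ifs <;> simp_all

theorem eval_mono (p : Polynomial ℕ) {m n : ℕ} (h : m ≤ n) : p.eval m ≤ p.eval n := by
  rw [Polynomial.eval_eq_sum_range, Polynomial.eval_eq_sum_range]
  gcongr

/-! ### Functions computed by programs in polynomial time -/

variable {ι κ α β : Type}

variable (O) in
/-- The function `f` of an abstract argument `a` is computed in polynomial time by a program from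
the variables `v i a`. The program finds the variables on stacks `loc i`, which it has to preserve,
writes the value from left to right on top of stack `o`, and may use the stacks from `m` on, which
are empty before and after. The length of the value and the running time are bounded by a polynomial
in any bound `B` on the lengths of the variables. -/
def PolyFun (v : ι → α → List Sym) (f : α → List Sym) : Prop :=
  ∃ p : Polynomial ℕ,
    (∀ a B, (∀ i, (v i a).length ≤ B) → (f a).length ≤ p.eval B) ∧
    ∀ (loc : ι → ℕ) (o m : ℕ), (∀ i, loc i < m) → o < m → (∀ i, loc i ≠ o) →
      ∃ P : Prog J, ∀ a S B, (∀ i, S (loc i) = v i a) → (∀ k, m ≤ k → S k = []) →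
        (∀ i, (v i a).length ≤ B) →
        Runs O P S (update S o ((f a).reverse ++ S o)) (p.eval B)

variable {v : ι → α → List Sym} {f g h : α → List Sym}

theorem PolyFun.congr (hf : PolyFun O v f) (h : ∀ a, f a = g a) : PolyFun O v g := by
  rwa [← funext h]

/-- Change of the argument and of the family of variables, provided that every old variable is still
available. -/
theorem PolyFun.comap (hf : PolyFun O v f) {v' : κ → β → List Sym} (ρ : ι → κ) (π : β → α)
    (h : ∀ i b, v' (ρ i) b = v i (π b)) : PolyFun O v' (fun b => f (π b)) := by
  obtain ⟨p, hp, hP⟩ := hf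
  refine ⟨p, fun b B hB => hp _ _ fun i => by rw [← h]; exact hB _, fun loc o m h1 h2 h3 => ?_⟩
  obtain ⟨P, hP⟩ := hP (loc ∘ ρ) o m (fun i => h1 _) h2 (fun i => h3 _)
  exact ⟨P, fun b S B hS hm hB => hP (π b) S B (fun i => by rw [← h]; exact hS _) hm
    (fun i => by rw [← h]; exact hB _)⟩

theorem PolyFun.const (l : List Sym) : PolyFun O v (fun _ => l) := by
  refine ⟨Polynomial.C (l.length + 1), fun a B hB => by simp, fun loc o m h1 h2 h3 => ?_⟩
  suffices ∃ P : Prog J, ∀ S, Runs O P S (update S o (l.reverse ++ S o)) (l.length + 1) by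
    obtain ⟨P, hP⟩ := this
    exact ⟨P, fun a S B _ _ _ => by simpa using hP S⟩
  clear h1 h2 h3 loc
  induction l with
  | nil => exact ⟨.skip, fun S => by simpa using Runs.skip S⟩
  | cons a l ih =>
    obtain ⟨P, hP⟩ := ih
    refine ⟨.seq (.push o a) P, fun S => ?_⟩
    have := (Runs.push S o a).seq (hP _)
    simp only [update_idem, update_self] at this
    simpa [add_comm] using this

theorem PolyFun.var (i : ι) : PolyFun O v (v i) := by
  -- The variable is popped to `o` and to the free stack `m`, and then restored from `m`.
  refine ⟨5 * .X + 2, fun a B hB => ?_, fun loc o m h1 h2 h3 => ?_⟩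
  · have := hB i; simp; omega
  refine ⟨.seq (.loop (loc i) fun a => .seq (.push m a) (.push o a))
    (.loop m fun a => .push (loc i) a), fun a S B hS hm hB => ?_⟩
  have e1 : loc i ≠ m := (h1 i).ne
  have := (Runs.move_two (O := O) e1 (h3 i) h2.ne' S).seq (Runs.move e1.symm _)
  have hB := hB i
  have e2 := h3 i
  have e3 := hm m le_rfl
  refine this.conv (fun k => ?_) (by simp [hS, h2.ne', e3]; omega)
  simp only [update_apply, hS]
  split_ifs <;> simp_all

theorem PolyFun.append (hf : PolyFun O v f) (hg : PolyFun O v g) : PolyFun O v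
    (fun a => f a ++ g a) := by
  obtain ⟨p, hp, hP⟩ := hf
  obtain ⟨q, hq, hQ⟩ := hg
  refine ⟨p + q, fun a B hB => by simpa using add_le_add (hp a B hB) (hq a B hB),
    fun loc o m h1 h2 h3 => ?_⟩
  obtain ⟨P, hP⟩ := hP loc o m h1 h2 h3
  obtain ⟨Q, hQ⟩ := hQ loc o m h1 h2 h3
  refine ⟨.seq P Q, fun a S B hS hm hB => ?_⟩
  have := (hP a S B hS hm hB).seq (hQ a _ B (fun i => by simp [h3, hS])
    (fun k hk => by rw [update_of_ne (by omega)]; exact hm k hk) hB)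
  simpa using this

/-- The value can also be produced in the right order, on an empty stack `x`. -/
theorem PolyFun.eval_to (hf : PolyFun O v f) : ∃ p : Polynomial ℕ,
    (∀ a B, (∀ i, (v i a).length ≤ B) → (f a).length ≤ p.eval B) ∧
    ∀ (loc : ι → ℕ) (x m : ℕ), (∀ i, loc i < m) → x < m → (∀ i, loc i ≠ x) →
      ∃ P : Prog J, ∀ a S B, (∀ i, S (loc i) = v i a) → (∀ k, m ≤ k → S k = []) → S x = [] →
        (∀ i, (v i a).length ≤ B) → Runs O P S (update S x (f a)) (p.eval B) := by
  obtain ⟨p, hp, hP⟩ := hf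
  refine ⟨3 * p + 1, fun a B hB => ?_, fun loc o m h1 h2 h3 => ?_⟩
  · have := hp a B hB; simp; omega
  obtain ⟨P, hP⟩ := hP loc m (m + 1) (fun i => (h1 i).trans (by omega)) (by omega)
    (fun i => (h1 i).ne)
  refine ⟨.seq P (.loop m fun a => .push o a), fun a S B hS hm hx hB => ?_⟩
  have hl := hp a B hB
  have := (hP a S B hS (fun k hk => hm k (by omega)) hB).seq (Runs.move h2.ne' _)
  have e3 := hm m le_rfl
  refine this.conv (fun k => ?_) (by simp [e3]; omega)
  simp only [update_apply]
  split_ifs <;> simp_all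

/-- The variables in the body of a loop: those outside it, and the loop counter in unary. -/
def withCounter (v : ι → α → List Sym) : Option ι → α × ℕ → List Sym
  | none, b => List.replicate b.2 (some true)
  | some i, b => v i b.1

/-- Closure under bounded loops. No bound on intermediate values is needed, because the values of
the body are only concatenated. -/
theorem PolyFun.flatMap {h : α → ℕ → List Sym} (hg : PolyFun O v g)
    (hh : PolyFun O (withCounter v) fun b => h b.1 b.2) :
    PolyFun O v (fun a => (List.range (g a).length).flatMap (h a)) := by
  obtain ⟨p, hp, hP⟩ := hg.eval_to
  obtain ⟨q, hq, hQ⟩ := hh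
  -- The counter is bounded by the number of iterations, hence polynomially.
  have hbd : ∀ a B, (∀ i, (v i a).length ≤ B) → ∀ j ≤ (g a).length, ∀ i,
      (withCounter v i (a, j)).length ≤ B + p.eval B := by
    intro a B hB j hj i
    have := hp a B hB
    rcases i with _ | i
    · simp [withCounter]; omega
    · have := hB i; simp [withCounter]; omega
  refine ⟨p + p * (q.comp (.X + p) + 2) + 2 * p + 2, fun a B hB => ?_, fun loc o m h1 h2 h3 => ?_⟩
  · have : ∀ n ≤ (g a).length, ((List.range n).flatMap (h a)).length ≤
        n * q.eval (B + p.eval B) := by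
      intro n hn
      induction n with
      | zero => simp
      | succ n ih =>
        have e := hq (a, n) _ (hbd a B hB n (by omega))
        have := ih (by omega)
        simp only [List.range_succ, List.flatMap_append, List.flatMap_singleton,
          List.length_append]
        simp only at e
        linarith
    have h1 := this _ le_rfl
    have h2 := Nat.mul_le_mul_right (q.eval (B + p.eval B)) (hp a B hB)
    simp only [Polynomial.eval_add, Polynomial.eval_mul, Polynomial.eval_comp, Polynomial.eval_X,
      Polynomial.eval_ofNat]
    linarith [Nat.zero_le (p.eval B)]
  -- Stack `m` holds one symbol per remaining iteration, and stack `m + 1` the counter in unary.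
  obtain ⟨P, hP⟩ := hP loc m (m + 2) (fun i => (h1 i).trans (by omega)) (by omega)
    (fun i => (h1 i).ne)
  obtain ⟨Q, hQ⟩ := hQ (fun i => i.elim (m + 1) loc) o (m + 2)
    (fun i => by cases i with | none => simp | some i => exact (h1 i).trans (by omega)) (by omega)
    (fun i => by cases i with | none => simp; omega | some i => exact h3 i)
  refine ⟨.seq P (.seq (.loop m fun _ => .seq Q (.push (m + 1) (some true)))
    (.loop (m + 1) fun _ => .skip)), fun a S B hS hm hB => ?_⟩
  have key : ∀ (l : List Sym) (j : ℕ) (S : ℕ → List Sym), j + l.length = (g a).length →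
      S m = l → S (m + 1) = List.replicate j (some true) → (∀ i, S (loc i) = v i a) →
      (∀ k, m + 2 ≤ k → S k = []) →
      Runs O (.loop m fun _ => .seq Q (.push (m + 1) (some true))) S
        (update (update (update S m []) (m + 1) (List.replicate (j + l.length) (some true))) o
          (((List.range' j l.length).flatMap (h a)).reverse ++ S o))
        (l.length * (q.eval (B + p.eval B) + 2) + 1) := by
    intro l
    induction l with
    | nil =>
      intro j S hj hl hu hS hm
      refine (Runs.loop_nil hl).conv (fun k => ?_) (by simp)
      by_cases k1 : k = o
      · subst k1; simp
      · by_cases k2 : k = m + 1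
        · subst k2; simp [k1, hu]
        · by_cases k3 : k = m
          · subst k3; simp [k1, hl]
          · simp [k1, k2, k3]
    | cons s l ih =>
      intro j S hj hl hu hS hm
      simp only [List.length_cons] at hj ⊢
      have r1 := hQ (a, j) (update S m l) (B + p.eval B)
        (fun i => by
          cases i with
          | none => simp [withCounter, hu]
          | some i => simp [withCounter, update_of_ne (h1 i).ne, hS])
        (fun k hk => by rw [update_of_ne (by omega), hm k (by omega)])
        (hbd a B hB j (by omega))
      have r2 := r1.seq (Runs.push _ (m + 1) (some true))
      have r3 := ih (j + 1) (update (update (update S m l) o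
        ((h a j).reverse ++ update S m l o)) (m + 1) (some true :: update (update S m l) o
        ((h a j).reverse ++ update S m l o) (m + 1))) (by omega) ?_ ?_ ?_ ?_
      · refine (Runs.loop_cons hl r2 r3).conv (fun k => ?_) ?_
        · by_cases k1 : k = o
          · subst k1
            simp [List.range'_succ, h2.ne, show k ≠ m + 1 by omega]
          · by_cases k2 : k = m + 1
            · simp [k2, show m + 1 ≠ o by omega]; omega
            · by_cases k3 : k = m
              · subst k3; simp [k1]
              · simp [k1, k2, k3]
        · linarith
      · simp [h2.ne']
      · simp [show m + 1 ≠ o by omega, hu, List.replicate_succ]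
      · intro i
        rw [update_of_ne (by have := h1 i; omega), update_of_ne (h3 i), update_of_ne (h1 i).ne, hS]
      · intro k hk
        rw [update_of_ne (by omega), update_of_ne (by omega), update_of_ne (by omega),
          hm k (by omega)]
  have r1 := hP a S B hS (fun k hk => hm k (by omega)) (hm m le_rfl) hB
  have r2 := key (g a) 0 (update S m (g a)) (by simp) (by simp)
    (by simpa using hm (m + 1) (by omega))
    (fun i => by rw [update_of_ne (h1 i).ne, hS])
    (fun k hk => by rw [update_of_ne (by omega), hm k (by omega)])
  have r3 := (r1.seq (r2.seq (Runs.clear (m + 1) _)))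
  refine r3.conv (fun k => ?_) (?_ : _ ≤ _)
  · have e1 := hm m le_rfl
    have e2 := hm (m + 1) (by omega)
    simp only [List.range_eq_range']
    by_cases k1 : k = o
    · subst k1
      simp [h2.ne, show k ≠ m + 1 by omega]
    · by_cases k2 : k = m + 1
      · simp [k2, e2, show m + 1 ≠ o by omega]
      · by_cases k3 : k = m
        · subst k3; simp [k1, e1]
        · simp [k1, k2, k3]
  · have e1 := hp a B hB
    have e2 := Nat.mul_le_mul_right (q.eval (B + p.eval B) + 2) e1
    simp only [Polynomial.eval_add, Polynomial.eval_mul, Polynomial.eval_comp, Polynomial.eval_X,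
      Polynomial.eval_ofNat, update_self, update_of_ne (show m + 1 ≠ o by omega),
      List.length_replicate, zero_add]
    linarith

theorem PolyFun.ite (hg : PolyFun O v g) (hf : PolyFun O v f) (hh : PolyFun O v h) :
    PolyFun O v (fun a => if g a = [] then f a else h a) := by
  obtain ⟨p, hp, hP⟩ := hg.eval_to
  obtain ⟨q, hq, hQ⟩ := hf
  obtain ⟨r, hr, hR⟩ := hh
  refine ⟨3 * p + q + r + 2, fun a B hB => ?_, fun loc o m h1 h2 h3 => ?_⟩
  · have e1 := hq a B hB
    have e2 := hr a B hB
    simp only [Polynomial.eval_add, Polynomial.eval_mul, Polynomial.eval_ofNat]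
    split_ifs <;> omega
  obtain ⟨P, hP⟩ := hP loc m (m + 1) (fun i => (h1 i).trans (by omega)) (by omega)
    (fun i => (h1 i).ne)
  obtain ⟨Q, hQ⟩ := hQ loc o m h1 h2 h3
  obtain ⟨R, hR⟩ := hR loc o m h1 h2 h3
  refine ⟨.seq P (.case m fun s => match s with
    | none => Q
    | some _ => .seq (.loop m fun _ => .skip) R), fun a S B hS hm hB => ?_⟩
  have r1 := hP a S B hS (fun k hk => hm k (by omega)) (hm m le_rfl) hB
  have r2 := hQ a S B hS hm hB
  have r3 := hR a S B hS hm hB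
  have e := hm m le_rfl
  have hl := hp a B hB
  have eS : update S m [] = S := by rw [← e, update_eq_self]
  simp only [Polynomial.eval_add, Polynomial.eval_mul, Polynomial.eval_ofNat]
  cases hg : g a with
  | nil =>
    refine (r1.seq (Runs.case (T := q.eval B) ?_)).mono
      (T := p.eval B + (q.eval B + 1)) (by omega)
    simpa [hg, eS] using r2
  | cons s l =>
    rw [hg, List.length_cons] at hl
    refine (r1.seq (Runs.case (T := 2 * l.length + 1 + r.eval B) ?_)).mono
      (T := p.eval B + (2 * l.length + 1 + r.eval B + 1)) (by omega)
    have r4 := Runs.clear (O := O) m (update S m l)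
    simp only [update_idem, update_self, eS] at r4
    simpa [hg] using r4.seq r3

variable (O) in
/-- The binary operation `op` is computed in linear time by a program that consumes its two
arguments. -/
def PolyOp (op : List Sym → List Sym → List Sym) : Prop :=
  ∃ C : ℕ, ∀ x y o : ℕ, x ≠ y → x ≠ o → y ≠ o → ∃ Q : Prog J, ∀ S,
    (op (S x) (S y)).length ≤ C * ((S x).length + (S y).length + 1) ∧
    Runs O Q S (update (update (update S x []) y []) o ((op (S x) (S y)).reverse ++ S o))
      (C * ((S x).length + (S y).length + 1))

theorem PolyFun.binop {op : List Sym → List Sym → List Sym} (hop : PolyOp O op) (hf : PolyFun O v f)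
    (hg : PolyFun O v g) : PolyFun O v (fun a => op (f a) (g a)) := by
  obtain ⟨C, hC⟩ := hop
  obtain ⟨p, hp, hP⟩ := hf.eval_to
  obtain ⟨q, hq, hQ⟩ := hg.eval_to
  have hle : ∀ a B, (∀ i, (v i a).length ≤ B) →
      C * ((f a).length + (g a).length + 1) ≤ C * (p.eval B + q.eval B + 1) := fun a B hB =>
    Nat.mul_le_mul_left _ (by have := hp a B hB; have := hq a B hB; omega)
  refine ⟨p + q + .C C * (p + q + 1), fun a B hB => ?_, fun loc o m h1 h2 h3 => ?_⟩
  · obtain ⟨Q, hQ⟩ := hC 0 1 2 (by omega) (by omega) (by omega)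
    have := (hQ (update (update (fun _ => []) 0 (f a)) 1 (g a))).1
    simp at this
    have := hle a B hB
    simp
    omega
  obtain ⟨P, hP⟩ := hP loc m (m + 2) (fun i => (h1 i).trans (by omega)) (by omega)
    (fun i => (h1 i).ne)
  obtain ⟨Q, hQ⟩ := hQ loc (m + 1) (m + 2) (fun i => (h1 i).trans (by omega)) (by omega)
    (fun i => by have := h1 i; omega)
  obtain ⟨R, hR⟩ := hC m (m + 1) o (by omega) (by omega) (by omega)
  refine ⟨.seq P (.seq Q R), fun a S B hS hm hB => ?_⟩
  have e1 := hm m le_rfl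
  have e2 := hm (m + 1) (by omega)
  have r1 := hP a S B hS (fun k hk => hm k (by omega)) e1 hB
  have r2 := hQ a (update S m (f a)) B (fun i => by rw [update_of_ne (h1 i).ne, hS])
    (fun k hk => by rw [update_of_ne (by omega), hm k (by omega)])
    (by rw [update_of_ne (by omega), e2]) hB
  have r3 := (hR (update (update S m (f a)) (m + 1) (g a))).2
  have hle := hle a B hB
  refine (r1.seq (r2.seq r3)).conv (fun k => ?_) (by simp; omega)
  by_cases k1 : k = o
  · subst k1
    simp [h2.ne, show k ≠ m + 1 by omega]
  · by_cases k2 : k = m + 1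
    · simp [k2, e2, show m + 1 ≠ o by omega]
    · by_cases k3 : k = m
      · subst k3; simp [k1, e1]
      · simp [k1, k2, k3]

theorem PolyOp.drop : PolyOp O fun x y => y.drop x.length := by
  refine ⟨4, fun x y o hxy hx hy => ⟨.seq (.loop x fun _ => .case y fun _ => .skip)
    (.loop y fun a => .push o a), fun S => ⟨by simp; omega, ?_⟩⟩⟩
  have key : ∀ (l : List Sym) S, S x = l → Runs O (.loop x fun _ => .case y fun _ => .skip) S
      (update (update S x []) y ((S y).drop l.length)) (3 * l.length + 1) := by
    intro l
    induction l with
    | nil =>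
      intro S hl
      refine (Runs.loop_nil hl).conv (fun k => ?_) (by simp)
      simp only [update_apply]
      split_ifs <;> simp_all
    | cons s l ih =>
      intro S hl
      have := Runs.loop_cons hl (Runs.case (P := fun _ => .skip) (.skip _)) (ih _ ?_)
      · refine this.conv (fun k => ?_) (by simp; omega)
        simp only [update_apply]
        split_ifs <;> simp_all
      · simp [hxy]
  refine ((key _ S rfl).seq (Runs.move hy _)).conv (fun k => ?_) (by simp; omega)
  simp only [update_apply]
  split_ifs <;> simp_all

theorem PolyOp.take : PolyOp O fun x y => y.take x.length := by
  refine ⟨4, fun x y o hxy hx hy => ⟨.seq (.loop x fun _ => .case y fun s => match s with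
      | none => .skip
      | some a => .push o a)
    (.loop y fun a => .skip), fun S => ⟨by simp; omega, ?_⟩⟩⟩
  have key : ∀ (l : List Sym) S, S x = l → Runs O (.loop x fun _ => .case y fun s => match s with
      | none => .skip
      | some a => .push o a) S
      (update (update (update S x []) y ((S y).drop l.length)) o
        (((S y).take l.length).reverse ++ S o)) (3 * l.length + 1) := by
    intro l
    induction l with
    | nil =>
      intro S hl
      refine (Runs.loop_nil hl).conv (fun k => ?_) (by simp)
      simp only [update_apply]
      split_ifs <;> simp_all
    | cons s l ih =>
      intro S hl
      have e : ∃ S', S' = update (update (update S x l) y (S y).tail) o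
          (((S y).take 1).reverse ++ S o) ∧
          Runs O (.case y fun s => match s with
            | none => .skip
            | some a => .push o a) (update S x l) S' 2 := by
        refine ⟨_, rfl, ?_⟩
        refine Runs.case (T := 1) ?_
        simp only [update_of_ne hxy.symm]
        cases hsy : S y with
        | nil =>
          refine (Runs.skip _).conv (fun k => ?_) le_rfl
          simp only [update_apply]
          split_ifs <;> simp_all
        | cons b t =>
          refine (Runs.push _ _ _).conv (fun k => ?_) le_rfl
          simp only [update_apply]
          split_ifs <;> simp_all
      obtain ⟨S', hS', e⟩ := e
      have := Runs.loop_cons hl e (ih S' ?_)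
      · refine this.conv (fun k => ?_) (by simp; omega)
        subst hS'
        simp only [update_apply]
        cases hsy : S y <;> split_ifs <;> simp_all
      · simp [hxy, hS', hx]
  refine ((key _ S rfl).seq (Runs.clear y _)).conv (fun k => ?_) (by simp [hy]; omega)
  simp only [update_apply]
  split_ifs <;> simp_all

/-- A list that is empty if and only if `x = y`, computed by comparing the two words symbol by
symbol. -/
def mismatch : List Sym → List Sym → List Sym
  | [], y => y
  | a :: x, y => (if y.head? = some a then [] else [none]) ++ mismatch x y.tail

theorem mismatch_eq_nil (x y : List Sym) : mismatch x y = [] ↔ x = y := by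
  induction x generalizing y with
  | nil => simp [mismatch, eq_comm]
  | cons a x ih => cases y with
    | nil => simp [mismatch]
    | cons b y => simp [mismatch, ih, eq_comm (a := a)]

theorem PolyOp.mismatch : PolyOp O mismatch := by
  have hlen : ∀ x y, (OneWay.mismatch x y).length ≤ x.length + y.length := by
    intro x
    induction x with
    | nil => simp [OneWay.mismatch]
    | cons a x ih =>
      intro y
      have := ih y.tail
      simp only [OneWay.mismatch]
      split_ifs <;> simp at * <;> omega
  refine ⟨4, fun x y o hxy hx hy => ⟨.seq (.loop x fun a => .case y fun s =>
      if s = some a then .skip else .push o none)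
    (.loop y fun a => .push o a), fun S => ⟨by have := hlen (S x) (S y); omega, ?_⟩⟩⟩
  have key : ∀ (l : List Sym) S, S x = l → Runs O (.loop x fun a => .case y fun s =>
      if s = some a then .skip else .push o none) S
      (update (update (update S x []) y ((S y).drop l.length)) o
        ((OneWay.mismatch l ((S y).take l.length)).reverse ++ S o)) (3 * l.length + 1) := by
    intro l
    induction l with
    | nil =>
      intro S hl
      refine (Runs.loop_nil hl).conv (fun k => ?_) (by simp)
      simp only [update_apply]
      split_ifs <;> simp_all [OneWay.mismatch]
    | cons s l ih =>
      intro S hl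
      have e : Runs O (.case y fun t => if t = some s then .skip else .push o none)
          (update S x l) (update (update (update S x l) y (S y).tail) o
            ((if (S y).head? = some s then [] else [none]) ++ S o)) 2 := by
        refine Runs.case (T := 1) ?_
        simp only [update_of_ne hxy.symm]
        split_ifs with h
        · refine (Runs.skip _).conv (fun k => ?_) le_rfl
          simp only [update_apply]
          split_ifs <;> simp_all
        · refine (Runs.push _ _ _).conv (fun k => ?_) le_rfl
          simp only [update_apply]
          split_ifs <;> simp_all
      have := Runs.loop_cons hl e (ih _ (by simp [hxy, hx]))
      refine this.conv (fun k => ?_) (by simp; omega)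
      simp only [update_apply]
      cases hsy : S y <;> split_ifs <;> simp_all [OneWay.mismatch]
  have happ : ∀ x y, OneWay.mismatch x (y.take x.length) ++ y.drop x.length =
      OneWay.mismatch x y := by
    intro x
    induction x with
    | nil => simp [OneWay.mismatch]
    | cons a x ih =>
      intro y
      have := ih y.tail
      cases y <;> simp_all [OneWay.mismatch]
  refine ((key _ S rfl).seq (Runs.move hy _)).conv (fun k => ?_) (by simp [hy]; omega)
  simp only [update_apply]
  split_ifs <;> simp_all
  rw [← happ (S x) (S y)]
  simp

/-- Closure under calls of a machine whose output length and running time are bounded by `p`. -/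
theorem PolyFun.call (j : J) (p : Polynomial ℕ) (hg : PolyFun O v g)
    (hf : ∀ a, ∃ w', w'.map (O j).enc = f a ∧ w'.length ≤ p.eval (g a).length ∧
      Nonempty (TM2OutputsInTime (O j).M ((g a).map (O j).dec) (some w')
        (p.eval (g a).length))) : PolyFun O v f := by
  obtain ⟨q, hq, hQ⟩ := hg
  refine ⟨2 * q + 2 * p.comp q + 2, fun a B hB => ?_, fun loc o m h1 h2 h3 => ?_⟩
  · obtain ⟨w', h1, h2, -⟩ := hf a
    have := eval_mono p (hq a B hB)
    rw [← h1, List.length_map]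
    simp
    omega
  obtain ⟨Q, hQ⟩ := hQ loc m (m + 1) (fun i => (h1 i).trans (by omega)) (by omega)
    (fun i => (h1 i).ne)
  refine ⟨.seq Q (.call j m o), fun a S B hS hm hB => ?_⟩
  obtain ⟨w', e1, e2, ⟨e3⟩⟩ := hf a
  have e := hm m le_rfl
  have := eval_mono p (hq a B hB)
  have := hq a B hB
  have r1 := hQ a S B hS (fun k hk => hm k (by omega)) hB
  have r2 : Runs O (.call j m o) _ _ _ :=
    ⟨_, le_rfl, Exec.call (S := update S m ((g a).reverse ++ S m)) (i := m) (o := o) e3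
      (by simp [e])⟩
  refine (r1.seq r2).conv (fun k => ?_) (by simp; omega)
  simp only [update_apply]
  split_ifs <;> simp_all

/-! ### Compilation of programs to multi-stack Turing machines -/

section Compile

variable {J : Type} (O : J → Oracle) (b : ℕ) (Γ₀ Γ₁ : Type)

/-- The stacks of a compiled program: its own stacks `0, …, b`, those of the machines it calls, the
input stack (`false`) and the output stack (`true`). -/
abbrev Stack : Type := Fin (b + 1) ⊕ ((Σ j, (O j).M.K) ⊕ Bool)

/-- The alphabets of the stacks of a compiled program. -/
@[reducible] def Alphabet : Stack O b → Type
  | .inl _ => Sym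
  | .inr (.inl p) => (O p.1).M.Γ p.2
  | .inr (.inr false) => Γ₀
  | .inr (.inr true) => Γ₁

/-- The internal state of a compiled program: the symbol that was popped last, and the internal
states of all machines that may be called. -/
abbrev Register : Type := Option Sym × (∀ j, (O j).M.σ)

variable {b Γ₀ Γ₁} in
/-- The contents of all stacks. Only the stacks `0, …, b` of `S` are represented. -/
def store (S : ℕ → List Sym) (T : ∀ j k, List ((O j).M.Γ k)) (I : List Γ₀) (U : List Γ₁) :
    ∀ k, List (Alphabet O b Γ₀ Γ₁ k)
  | .inl k => S k
  | .inr (.inl p) => T p.1 p.2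
  | .inr (.inr false) => I
  | .inr (.inr true) => U

variable {O b Γ₀ Γ₁}

variable (O) in
/-- The labels of the code of a program. -/
def Label : Prog J → Type
  | .skip => Unit
  | .push _ _ => Unit
  | .seq P Q => Label P ⊕ Label Q
  | .case _ P => Option (Σ s, Label (P s))
  | .loop _ P => Option (Σ a, Label (P a))
  | .call j _ _ => Option (Option (O j).M.Λ)

variable (O) in
/-- The label at which the code of a program starts. -/
def entry : ∀ P : Prog J, Label O P
  | .skip => ()
  | .push _ _ => ()
  | .seq P _ => .inl (entry P)
  | .case _ _ => none
  | .loop _ _ => none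
  | .call _ _ _ => none

theorem finite_label (P : Prog J) : Finite (Label O P) := by
  induction P with
  | skip => exact inferInstanceAs (Finite Unit)
  | push k a => exact inferInstanceAs (Finite Unit)
  | seq P Q h1 h2 => exact inferInstanceAs (Finite (Label O P ⊕ Label O Q))
  | case k P h => exact inferInstanceAs (Finite (Option (Σ s, Label O (P s))))
  | loop k P h => exact inferInstanceAs (Finite (Option (Σ s, Label O (P s))))
  | call j i o =>
    have := (O j).M.ΛFin
    exact inferInstanceAs (Finite (Option (Option (O j).M.Λ)))

/-- Only the stacks `0, …, b` occur in the program. -/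
def Prog.Bdd (b : ℕ) : Prog J → Prop
  | .skip => True
  | .push k _ => k ≤ b
  | .seq P Q => P.Bdd b ∧ Q.Bdd b
  | .case k P => k ≤ b ∧ ∀ s, (P s).Bdd b
  | .loop k P => k ≤ b ∧ ∀ s, (P s).Bdd b
  | .call _ i o => i ≤ b ∧ o ≤ b

theorem Prog.Bdd.mono {b b' : ℕ} (h : b ≤ b') {P : Prog J} (hP : P.Bdd b) : P.Bdd b' := by
  induction P with
  | skip => trivial
  | push k a => exact le_trans hP h
  | seq P Q h1 h2 => exact ⟨h1 hP.1, h2 hP.2⟩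
  | case k P ih => exact ⟨hP.1.trans h, fun s => ih s (hP.2 s)⟩
  | loop k P ih => exact ⟨hP.1.trans h, fun s => ih s (hP.2 s)⟩
  | call j i o => exact ⟨hP.1.trans h, hP.2.trans h⟩

theorem Prog.exists_bdd (P : Prog J) : ∃ b, P.Bdd b := by
  induction P with
  | skip => exact ⟨0, trivial⟩
  | push k a => exact ⟨k, le_refl k⟩
  | seq P Q h1 h2 =>
    obtain ⟨b1, h1⟩ := h1
    obtain ⟨b2, h2⟩ := h2
    exact ⟨b1 + b2, h1.mono (by omega), h2.mono (by omega)⟩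
  | case k P ih =>
    choose f hf using ih
    refine ⟨k + ∑ s, f s, by omega, fun s => (hf s).mono ?_⟩
    have := Finset.single_le_sum (f := f) (fun _ _ => Nat.zero_le _) (Finset.mem_univ s)
    omega
  | loop k P ih =>
    choose f hf using ih
    refine ⟨k + ∑ s, f s, by omega, fun s => (hf s).mono ?_⟩
    have := Finset.single_le_sum (f := f) (fun _ _ => Nat.zero_le _) (Finset.mem_univ s)
    omega
  | call j i o => exact ⟨i + o, by omega, by omega⟩

theorem val_ofNat {b k : ℕ} (h : k ≤ b) : (Fin.ofNat (b + 1) k : ℕ) = k := by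
  simp [Nat.mod_eq_of_lt (show k < b + 1 by omega)]

variable [DecidableEq J]
variable (S : ℕ → List Sym) (T : ∀ j k, List ((O j).M.Γ k)) (I : List Γ₀) (U : List Γ₁)

theorem update_store_loc (k : Fin (b + 1)) (l : List Sym) :
    update (store O (b := b) S T I U) (.inl k) l = store O (update S k l) T I U := by
  funext x
  rcases x with x | x | x | x
  · by_cases h : x = k
    · subst h; simp [store]
    · have h' : (x : ℕ) ≠ k := fun e => h (Fin.ext e)
      simp [store, h, h']
  · simp [store]
  · simp [store]
  · simp [store]

theorem update_store_orc (j : J) (k : (O j).M.K) (l : List ((O j).M.Γ k)) :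
    update (store O (b := b) S T I U) (.inr (.inl ⟨j, k⟩)) l =
      store O S (update T j (update (T j) k l)) I U := by
  funext x
  rcases x with x | ⟨j', k'⟩ | x | x
  · simp [store]
  · by_cases h : j' = j
    · subst h
      by_cases h : k' = k
      · subst h; simp [store]
      · have h' : (Sum.inr (Sum.inl ⟨j', k'⟩) : Stack O b) ≠ .inr (.inl ⟨j', k⟩) := by
          simpa using h
        rw [update_of_ne h']
        simp [store, h]
    · have h' : (Sum.inr (Sum.inl ⟨j', k'⟩) : Stack O b) ≠ .inr (.inl ⟨j, k⟩) := by
        intro e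
        simp only [Sum.inr.injEq, Sum.inl.injEq] at e
        exact h (congrArg Sigma.fst e)
      rw [update_of_ne h']
      simp [store, h]
  · simp [store]
  · simp [store]

theorem update_store_in (l : List Γ₀) :
    update (store O (b := b) S T I U) (.inr (.inr false)) l = store O S T l U := by
  funext x
  rcases x with x | x | x | x <;> simp [store]

theorem update_store_out (l : List Γ₁) :
    update (store O (b := b) S T I U) (.inr (.inr true)) l = store O S T I l := by
  funext x
  rcases x with x | x | x | x <;> simp [store]

variable (O b Γ₀ Γ₁) in
/-- The statements of compiled programs, with labels in `Λ`. -/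
abbrev CodeStmt (Λ : Type) : Type := TM2.Stmt (Alphabet O b Γ₀ Γ₁) Λ (Register O)

section
variable {Λ : Type}

/-- A statement of machine `j` as a statement of a compiled program. Halting becomes a jump to
`emb none`. -/
def liftStmt (j : J) (emb : Option (O j).M.Λ → Λ) :
    TM2.Stmt (O j).M.Γ (O j).M.Λ (O j).M.σ → CodeStmt O b Γ₀ Γ₁ Λ
  | .push k f q => .push (.inr (.inl ⟨j, k⟩)) (fun v => f (v.2 j)) (liftStmt j emb q)
  | .peek k f q => .peek (.inr (.inl ⟨j, k⟩))
      (fun v s => (v.1, update v.2 j (f (v.2 j) s))) (liftStmt j emb q)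
  | .pop k f q => .pop (.inr (.inl ⟨j, k⟩))
      (fun v s => (v.1, update v.2 j (f (v.2 j) s))) (liftStmt j emb q)
  | .load f q => .load (fun v => (v.1, update v.2 j (f (v.2 j)))) (liftStmt j emb q)
  | .branch f q q' => .branch (fun v => f (v.2 j)) (liftStmt j emb q) (liftStmt j emb q')
  | .goto f => .goto fun v => emb (some (f (v.2 j)))
  | .halt => .goto fun _ => emb none

variable (b Γ₀ Γ₁) in
/-- The code of a program inside a larger one: `emb` embeds its labels into the labels of the whole,
and it jumps to `exit` when it is done. -/
def code : ∀ (P : Prog J), (Label O P → Λ) → Λ → Label O P → CodeStmt O b Γ₀ Γ₁ Λ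
  | .skip, _, exit, _ => .goto fun _ => exit
  | .push k a, _, exit, _ => .push (.inl (Fin.ofNat (b + 1) k)) (fun _ => a) (.goto fun _ => exit)
  | .seq P Q, emb, exit, l => match l with
    | .inl l => code P (fun l => emb (.inl l)) (emb (.inr (entry O Q))) l
    | .inr l => code Q (fun l => emb (.inr l)) exit l
  | .case k P, emb, exit, l => match l with
    | none => .pop (.inl (Fin.ofNat (b + 1) k)) (fun v s => (s, v.2))
        (.goto fun v => emb (some ⟨v.1, entry O (P v.1)⟩))
    | some ⟨s, l⟩ => code (P s) (fun l => emb (some ⟨s, l⟩)) exit l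
  | .loop k P, emb, exit, l => match l with
    | none => .pop (.inl (Fin.ofNat (b + 1) k)) (fun v s => (s, v.2))
        (.goto fun v => match v.1 with
          | none => exit
          | some a => emb (some ⟨a, entry O (P a)⟩))
    | some ⟨a, l⟩ => code (P a) (fun l => emb (some ⟨a, l⟩)) (emb none) l
  | .call j i o, emb, exit, l => match l with
    | none => .pop (.inl (Fin.ofNat (b + 1) i)) (fun v s => (s, v.2))
        (.branch (fun v => v.1.isSome)
          (.push (.inr (.inl ⟨j, (O j).M.k₀⟩)) (fun v => (O j).dec (v.1.getD none))
            (.goto fun _ => emb none))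
          (.goto fun _ => emb (some (some (O j).M.main))))
    | some none => .pop (.inr (.inl ⟨j, (O j).M.k₁⟩)) (fun v s => (s.map (O j).enc, v.2))
        (.branch (fun v => v.1.isSome)
          (.push (.inl (Fin.ofNat (b + 1) o)) (fun v => v.1.getD none)
              (.goto fun _ => emb (some none)))
          (.goto fun _ => exit))
    | some (some l) => liftStmt j (fun l => emb (some l)) ((O j).M.m l)

end

/-- The machine `m` gets from `c` to `c'` in at most `T` steps. -/
def Steps {K : Type} [DecidableEq K] {Γ : K → Type} {Λ σ : Type} (m : Λ → TM2.Stmt Γ Λ σ)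
    (T : ℕ) (c c' : TM2.Cfg Γ Λ σ) : Prop :=
  ∃ n ≤ T, (flip bind (TM2.step m))^[n] (some c) = some c'

section
variable {K : Type} [DecidableEq K] {Γ : K → Type} {Λ σ : Type} {m : Λ → TM2.Stmt Γ Λ σ}
  {c c' c'' : TM2.Cfg Γ Λ σ} {t t' : ℕ}

theorem Steps.refl : Steps m 0 c c := ⟨0, le_rfl, rfl⟩

theorem Steps.mono (h : Steps m t c c') (ht : t ≤ t') : Steps m t' c c' := by
  obtain ⟨n, hn, h⟩ := h
  exact ⟨n, hn.trans ht, h⟩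

theorem Steps.trans (h : Steps m t c c') (h' : Steps m t' c' c'') : Steps m (t + t') c c'' := by
  obtain ⟨n, hn, h⟩ := h
  obtain ⟨n', hn', h'⟩ := h'
  refine ⟨n' + n, by omega, ?_⟩
  rw [iterate_add_apply, h, h']

theorem Steps.head {l : Λ} {v : σ} {S : ∀ k, List (Γ k)}
    (h : Steps m t (TM2.stepAux (m l) v S) c') : Steps m (t + 1) ⟨some l, v, S⟩ c' := by
  obtain ⟨n, hn, h⟩ := h
  exact ⟨n + 1, by omega, by rw [iterate_succ_apply]; exact h⟩

end

section
variable {Λ : Type}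

theorem stepAux_liftStmt (j : J) (emb : Option (O j).M.Λ → Λ)
    (q : TM2.Stmt (O j).M.Γ (O j).M.Λ (O j).M.σ) (v : Register O)
    (S : ℕ → List Sym) (T : ∀ j k, List ((O j).M.Γ k)) (I : List Γ₀) (U : List Γ₁) :
    TM2.stepAux (liftStmt j emb q) v (store O (b := b) S T I U) =
      ⟨some (emb (TM2.stepAux q (v.2 j) (T j)).l),
        (v.1, update v.2 j (TM2.stepAux q (v.2 j) (T j)).var),
        store O S (update T j (TM2.stepAux q (v.2 j) (T j)).stk) I U⟩ := by
  induction q generalizing v T with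
  | push k f q ih =>
    simp only [liftStmt, TM2.stepAux, update_store_orc, ih]
    simp [store]
  | peek k f q ih => 
    simp only [liftStmt, TM2.stepAux, ih]
    simp [store]
  | pop k f q ih =>
    simp only [liftStmt, TM2.stepAux, update_store_orc, ih]
    simp [store]
  | load f q ih => simp [liftStmt, ih]
  | branch f q q' h h' =>
    simp only [liftStmt, TM2.stepAux, h, h']
    cases f (v.2 j) <;> rfl
  | goto f => simp [liftStmt, TM2.stepAux]
  | halt => simp [liftStmt, TM2.stepAux]

variable {m : Λ → CodeStmt O b Γ₀ Γ₁ Λ}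

theorem steps_liftStmt {j : J} {emb : Option (O j).M.Λ → Λ}
    (hm : ∀ l, m (emb (some l)) = liftStmt j emb ((O j).M.m l)) (n : ℕ)
    {c c' : TM2.Cfg (O j).M.Γ (O j).M.Λ (O j).M.σ}
    (h : (flip bind (TM2.step (O j).M.m))^[n] (some c) = some c') (r : Option Sym)
    (V : ∀ j, (O j).M.σ) (T : ∀ j k, List ((O j).M.Γ k)) :
    Steps m n ⟨some (emb c.l), (r, update V j c.var), store O S (update T j c.stk) I U⟩
      ⟨some (emb c'.l), (r, update V j c'.var), store O S (update T j c'.stk) I U⟩ := by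
  induction n generalizing c with
  | zero =>
    cases h
    exact .refl
  | succ n ih =>
    rw [iterate_succ_apply] at h
    rcases c with ⟨_ | l, v, s⟩
    · have : ∀ n, (flip bind (TM2.step (O j).M.m))^[n] none = none := fun n => by
        induction n with
        | zero => rfl
        | succ n ih => rw [iterate_succ_apply]; exact ih
      have e : flip bind (TM2.step (O j).M.m) (some ⟨none, v, s⟩) = none := rfl
      rw [e, this] at h
      cases h
    · have e : flip bind (TM2.step (O j).M.m) (some ⟨some l, v, s⟩) =
        some (TM2.stepAux ((O j).M.m l) v s) := rfl
      rw [e] at h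
      refine Steps.head ?_
      rw [hm, stepAux_liftStmt]
      simpa using ih h

variable (O) in
/-- All machines that may be called are in their initial states. -/
def idle : ∀ j, (O j).M.σ := fun j => (O j).M.initialState

variable (O) in
/-- All stacks of the machines that may be called are empty. -/
def blank : ∀ j k, List ((O j).M.Γ k) := fun _ _ => []

theorem initList_stk (tm : FinTM2) (s : List (tm.Γ tm.k₀)) :
    (initList tm s).stk = update (fun _ => []) tm.k₀ s := by
  funext k
  by_cases h : k = tm.k₀
  · subst h; simp [initList]
  · simp [initList, h]

theorem haltList_stk (tm : FinTM2) (s : List (tm.Γ tm.k₁)) :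
    (haltList tm s).stk = update (fun _ => []) tm.k₁ s := by
  funext k
  by_cases h : k = tm.k₁
  · subst h; simp [haltList]
  · simp [haltList, h]

variable (O) in
/-- Only stack `k` of machine `j` is in use, with content `l`. -/
def single (j : J) (k : (O j).M.K) (l : List ((O j).M.Γ k)) : ∀ j k, List ((O j).M.Γ k) :=
  update (blank O) j (update (fun _ => []) k l)

theorem single_nil (j : J) (k : (O j).M.K) : single O j k [] = blank O := by
  have : update (fun _ => []) k [] = blank O j := by
    funext k'
    by_cases h : k' = k
    · subst h; simp [blank]
    · simp [blank, h]
  rw [single, this, update_eq_self]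

theorem update_single (j : J) (k : (O j).M.K) (l l' : List ((O j).M.Γ k)) :
    update (single O j k l) j (update (single O j k l j) k l') = single O j k l' := by
  simp [single]

theorem single_self (j : J) (k : (O j).M.K) (l : List ((O j).M.Γ k)) : single O j k l j k = l := by
  simp [single]

/-- Correctness of the compilation, by induction on the execution. The content of the symbol
register is irrelevant. -/
theorem steps_code {P : Prog J} {S S' : ℕ → List Sym} {t : ℕ} (h : Exec O P S S' t)
    (hb : P.Bdd b) {emb : Label O P → Λ} {exit : Λ} {m : Λ → CodeStmt O b Γ₀ Γ₁ Λ}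
    (hm : ∀ l, m (emb l) = code b Γ₀ Γ₁ P emb exit l) (r : Option Sym) :
    ∃ r', Steps m t ⟨some (emb (entry O P)), (r, idle O), store O S (blank O) I U⟩
      ⟨some exit, (r', idle O), store O S' (blank O) I U⟩ := by
  induction h generalizing exit r with
  | skip S =>
    refine ⟨r, Steps.head ?_⟩
    rw [hm]
    exact .refl
  | push S k a =>
    refine ⟨r, Steps.head ?_⟩
    rw [hm]
    simp only [code, TM2.stepAux, update_store_loc, val_ofNat (show k ≤ b from hb)]
    simp only [store, val_ofNat (show k ≤ b from hb)]
    exact .refl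
  | seq h1 h2 ih1 ih2 =>
    obtain ⟨r1, h1⟩ := ih1 hb.1 (emb := fun l => emb (Sum.inl l)) (fun l => hm (Sum.inl l)) r
    obtain ⟨r2, h2⟩ := ih2 hb.2 (emb := fun l => emb (Sum.inr l)) (fun l => hm (Sum.inr l)) r1
    exact ⟨r2, h1.trans h2⟩
  | @case k P S S' t h ih =>
    obtain ⟨r1, h1⟩ := ih (hb.2 _) (emb := fun l => emb (Option.some ⟨_, l⟩))
      (fun l => hm (Option.some ⟨_, l⟩)) (S k).head?
    refine ⟨r1, Steps.head ?_⟩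
    rw [hm]
    simp only [entry, code, TM2.stepAux, update_store_loc]
    simp only [store]
    generalize hk : ((Fin.ofNat (b + 1) k : Fin (b + 1)) : ℕ) = k'
    obtain rfl : k' = k := hk.symm.trans (val_ofNat hb.1)
    exact h1
  | @loop_nil k P S h =>
    refine ⟨none, Steps.head ?_⟩
    rw [hm]
    simp only [entry, code, TM2.stepAux, update_store_loc]
    simp only [store, val_ofNat hb.1, h, List.head?_nil, List.tail_nil]
    rw [← h, update_eq_self]
    exact .refl
  | @loop_cons k P S S' S'' t t' a l hk h1 h2 ih1 ih2 =>
    obtain ⟨r1, h1⟩ := ih1 (hb.2 a) (emb := fun l => emb (Option.some ⟨a, l⟩))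
      (fun l => hm (Option.some ⟨a, l⟩)) (some a)
    obtain ⟨r2, h2⟩ := ih2 hb hm r1
    refine ⟨r2, Steps.head ?_⟩
    rw [hm]
    simp only [entry, code, TM2.stepAux, update_store_loc]
    simp only [store, val_ofNat hb.1, hk, List.head?_cons, List.tail_cons]
    exact h1.trans h2
  | @call j i o S w w' T hM hS =>
    obtain ⟨e, rfl⟩ : ∃ e : Option (Option (O j).M.Λ) → Λ, e = emb := ⟨emb, rfl⟩
    have m0 : m (e none) = _ := hm none
    have m1 : m (e (some none)) = _ := hm (some none)
    have load : ∀ (l : List Sym) (S : ℕ → List Sym) (acc : List ((O j).M.Γ (O j).M.k₀))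
        (r : Option Sym), S i = l →
        Steps m (l.length + 1) ⟨some (e none), (r, idle O),
          store O S (single O j (O j).M.k₀ acc) I U⟩
          ⟨some (e (some (some (O j).M.main))), (none, idle O), store O (update S i [])
            (single O j (O j).M.k₀ ((l.map (O j).dec).reverse ++ acc)) I U⟩ := by
      intro l
      induction l with
      | nil =>
        intro S acc r hl
        refine Steps.head ?_
        rw [m0]
        simp only [code, TM2.stepAux, update_store_loc]
        simp only [store, val_ofNat hb.1, hl]
        exact .refl
      | cons a l ih =>
        intro S acc r hl
        refine Steps.head ?_
        rw [m0]
        simp only [code, TM2.stepAux, update_store_loc, update_store_orc]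
        simp only [store, val_ofNat hb.1, hl, update_single, single_self]
        have := ih (update S i l) ((O j).dec a :: acc) (some a) (by simp)
        rw [update_idem] at this
        simpa using this
    have unload : ∀ (l : List ((O j).M.Γ (O j).M.k₁)) (S : ℕ → List Sym)
        (r : Option Sym),
        Steps m (l.length + 1) ⟨some (e (some none)), (r, idle O),
          store O S (single O j (O j).M.k₁ l) I U⟩
          ⟨some exit, (none, idle O), store O (update S o ((l.map (O j).enc).reverse ++ S o))
            (blank O) I U⟩ := by
      intro l
      induction l with
      | nil =>
        intro S r
        refine Steps.head ?_
        rw [m1]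
        simp only [code, TM2.stepAux, update_store_orc]
        simp only [store, update_single, single_self, List.tail_nil]
        simp only [List.map_nil, List.reverse_nil, List.nil_append, update_eq_self, single_nil]
        exact .refl
      | cons a l ih =>
        intro S r
        refine Steps.head ?_
        rw [m1]
        simp only [code, TM2.stepAux, update_store_loc, update_store_orc]
        simp only [store, val_ofNat hb.2, update_single, single_self, List.tail_cons]
        have := ih (update S o ((O j).enc a :: S o)) (some ((O j).enc a))
        rw [update_idem, update_self] at this
        simpa using this
    have h1 := load w.reverse S [] r hS
    rw [single_nil] at h1
    have h2 := unload w' (update S i []) none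
    have h3 := steps_liftStmt (m := m) (j := j) (emb := fun l => e (some l))
      (S := update S i []) (I := I) (U := U) (fun l => hm (some (some l))) hM.steps
      hM.evals_in_steps none (idle O) (blank O)
    rw [initList_stk, haltList_stk] at h3
    have e' : update (idle O) j (O j).M.initialState = idle O := update_eq_self j (idle O)
    simp only [initList, haltList, e'] at h3
    refine ⟨none, ((h1.trans (Steps.trans ?_ h2))).mono (t := w.reverse.length + 1 +
      (T + (w'.length + 1))) (by simp; omega)⟩
    refine Steps.mono ?_ hM.steps_le_m
    simpa [single, ← List.map_reverse] using h3

end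
end Compile

/-! ### From programs to `FinTM2` -/

section Machine

variable {J : Type} [DecidableEq J] (O : J → Oracle) (b : ℕ) {Γ₀ Γ₁ : Type}
  (dec : Γ₀ → Sym) (enc : Sym → Γ₁)

/-- The code of a complete machine: it moves the input to stack `0`, runs the program, and moves
stack `1` to the output. -/
def machineCode (P : Prog J) : Label O P ⊕ Bool → CodeStmt O b Γ₀ Γ₁ (Label O P ⊕ Bool)
  | .inl l => code b Γ₀ Γ₁ P .inl (.inr true) l
  | .inr false => .pop (.inr (.inr false)) (fun v s => (s.map dec, v.2))
      (.branch (fun v => v.1.isSome)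
        (.push (.inl (Fin.ofNat (b + 1) 0)) (fun v => v.1.getD none)
          (.goto fun _ => .inr false))
        (.goto fun _ => .inl (entry O P)))
  | .inr true => .pop (.inl (Fin.ofNat (b + 1) 1)) (fun v s => (s, v.2))
      (.branch (fun v => v.1.isSome)
        (.push (.inr (.inr true)) (fun v => enc (v.1.getD none)) (.goto fun _ => .inr true))
        .halt)

theorem update_blank_in (w : List Γ₀) :
    update (β := fun k => List (Alphabet O b Γ₀ Γ₁ k)) (fun _ => []) (.inr (.inr false)) w =
    store (Γ₁ := Γ₁) O (b := b) (fun _ => []) (blank O) w [] := by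
  rw [← update_store_in (I := [])]
  congr 1
  funext x
  rcases x with x | x | x | x <;> rfl

theorem update_blank_out (w : List Γ₁) :
    update (β := fun k => List (Alphabet O b Γ₀ Γ₁ k)) (fun _ => []) (.inr (.inr true)) w =
    store (Γ₀ := Γ₀) O (b := b) (fun _ => []) (blank O) [] w := by
  rw [← update_store_out (U := [])]
  congr 1
  funext x
  rcases x with x | x | x | x <;> rfl

variable [Fintype J] [Fintype Γ₀]

/-- The Turing machine with code `machineCode`. -/
noncomputable def machine (P : Prog J) : FinTM2 :=
  haveI : ∀ j, Fintype (O j).M.K := fun j => (O j).M.kFin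
  haveI : ∀ j, Fintype (O j).M.σ := fun j => (O j).M.σFin
  haveI : Finite (Label O P) := finite_label P
  { K := Stack O b
    k₀ := .inr (.inr false)
    k₁ := .inr (.inr true)
    Γ := Alphabet O b Γ₀ Γ₁
    Λ := Label O P ⊕ Bool
    ΛFin := Fintype.ofFinite _
    main := .inr false
    σ := Register O
    initialState := (none, idle O)
    Γk₀Fin := inferInstanceAs (Fintype Γ₀)
    m := machineCode O b dec enc P }

theorem machine_outputs {P : Prog J} (hb : P.Bdd b) (hb' : 1 ≤ b) (w : List Γ₀) (w' : List Sym)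
    {t : ℕ} (h : Runs O P (update (fun _ => []) 0 (w.map dec).reverse)
      (update (fun _ => []) 1 w'.reverse) t) :
    Nonempty (TM2OutputsInTime (machine O b dec enc P) w (some (w'.map enc))
      (w.length + t + w'.length + 2)) := by
  obtain ⟨t', ht', h⟩ := h
  obtain ⟨m, hm⟩ : ∃ m, m = machineCode O b dec enc P := ⟨_, rfl⟩
  have m0 : m (.inr false) = _ := congrFun hm _
  have m1 : m (.inr true) = _ := congrFun hm _
  have load : ∀ (w : List Γ₀) (acc : List Sym) (r : Option Sym), Steps m (w.length + 1)
      ⟨some (.inr false), (r, idle O), store O (update (fun _ => []) 0 acc) (blank O) w []⟩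
      ⟨some (.inl (entry O P)), (none, idle O), store O (update (fun _ => []) 0
        ((w.map dec).reverse ++ acc)) (blank O) [] []⟩ := by
    intro w
    induction w with
    | nil =>
      intro acc r
      refine Steps.head ?_
      rw [m0]
      simp only [machineCode, TM2.stepAux, update_store_in]
      simp only [store]
      exact .refl
    | cons a w ih =>
      intro acc r
      refine Steps.head ?_
      rw [m0]
      simp only [machineCode, TM2.stepAux, update_store_in, update_store_loc]
      simp only [store, val_ofNat (Nat.zero_le b), update_idem, update_self]
      simpa using ih (dec a :: acc) (some (dec a))
  have unload : ∀ (w : List Sym) (acc : List Γ₁) (r : Option Sym), Steps m (w.length + 1)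
      ⟨some (.inr true), (r, idle O), store O (update (fun _ => []) 1 w) (blank O) [] acc⟩
      ⟨none, (none, idle O), store O (fun _ => []) (blank O) []
        ((w.map enc).reverse ++ acc)⟩ := by
    intro w
    induction w with
    | nil =>
      intro acc r
      refine Steps.head ?_
      rw [m1]
      simp only [machineCode, TM2.stepAux, update_store_loc, update_store_out]
      simp only [store, val_ofNat hb', update_idem, update_self, List.tail_nil]
      rw [show update (fun _ => []) 1 [] = (fun _ : ℕ => ([] : List Sym)) from
        update_eq_self 1 (fun _ : ℕ => ([] : List Sym))]
      exact .refl
    | cons a w ih =>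
      intro acc r
      refine Steps.head ?_
      rw [m1]
      simp only [machineCode, TM2.stepAux, update_store_loc, update_store_out]
      simp only [store, val_ofNat hb', update_idem, update_self, List.tail_cons]
      simpa using ih (enc a :: acc) (some a)
  obtain ⟨r, h⟩ := steps_code (I := ([] : List Γ₀)) (U := ([] : List Γ₁)) h hb
    (emb := .inl) (exit := .inr true) (m := m) (fun l => congrFun hm _) none
  have h1 := load w [] none
  rw [List.append_nil] at h1
  obtain ⟨n, hn, e⟩ := (h1.trans (h.trans (unload w'.reverse [] r))).mono
    (t' := w.length + t + w'.length + 2) (by simp; omega)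
  subst hm
  refine ⟨⟨⟨n, ?_⟩, hn⟩⟩
  have i1 : initList (machine O b dec enc P) w = ⟨some (.inr false), (none, idle O),
      store O (update (fun _ => []) 0 []) (blank O) w []⟩ := by
    rw [show update (fun _ => []) 0 [] = (fun _ : ℕ => ([] : List Sym)) from
        update_eq_self 0 (fun _ : ℕ => ([] : List Sym)), ← update_blank_in]
    exact congrArg (TM2.Cfg.mk _ _) (initList_stk (machine O b dec enc P) w)
  have i2 : haltList (machine O b dec enc P) (w'.map enc) = ⟨none, (none, idle O),
      store O (fun _ => []) (blank O) [] (((w'.reverse).map enc).reverse ++ [])⟩ := by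
    rw [← update_blank_out]
    refine (congrArg (TM2.Cfg.mk _ _) (haltList_stk (machine O b dec enc P) (w'.map enc))).trans ?_
    rw [List.append_nil, List.map_reverse, List.reverse_reverse]
    rfl
  rw [i1]
  exact e.trans (congrArg some i2.symm)

variable {O} in
/-- A function computed by a program from its encoded argument is computable in polynomial time by a
Turing machine. -/
theorem PolyFun.tm2Computable {α β : Type} {ea : α → List Γ₀} {eb : β → List Γ₁} {f : α → β}
    {out : α → List Sym} (hf : PolyFun O (fun (_ : Unit) a => (ea a).map dec) out)
    (hout : ∀ a, (out a).map enc = eb (f a)) : Nonempty (TM2ComputableInPolyTime ea eb f) := by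
  obtain ⟨p, hp, hP⟩ := hf
  obtain ⟨P, hP⟩ := hP (fun _ => 2) 1 3 (by simp) (by simp) (by simp)
  set Q : Prog J := .seq (.loop 0 fun a => .push 2 a) (.seq P (.loop 2 fun _ => .skip)) with hQ
  obtain ⟨b, hb⟩ := Q.exists_bdd
  refine ⟨⟨⟨machine O (b + 1) dec enc Q, Equiv.refl Γ₀, Equiv.refl Γ₁⟩, 6 * .X + 2 * p + 6,
    fun a => Nonempty.some ?_⟩⟩
  have r1 := Runs.move (O := O) (show 0 ≠ 2 by omega)
    (update (fun _ => []) 0 ((ea a).map dec).reverse)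
  have r2 := hP a (update (fun _ => []) 2 ((ea a).map dec)) (ea a).length (by simp)
    (fun k hk => by rw [update_of_ne (by omega)]) (by simp)
  have r3 := Runs.clear (O := O) 2 (update (update (fun _ => []) 2 ((ea a).map dec)) 1
    (out a).reverse)
  have r : Runs O Q (update (fun _ => []) 0 ((ea a).map dec).reverse)
      (update (fun _ => []) 1 (out a).reverse) (4 * (ea a).length + p.eval (ea a).length + 4) := by
    refine (Runs.seq (r1.conv (fun k => ?_) le_rfl) (Runs.seq
      (r2.conv (fun k => ?_) le_rfl) r3)).conv (fun k => ?_) ?_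
    · simp only [update_apply]; split_ifs <;> simp_all
    · simp
    · simp only [update_apply]; split_ifs <;> simp_all
    · simp; omega
  obtain ⟨h⟩ := machine_outputs O (b + 1) dec enc (hb.mono (Nat.le_succ b)) (by omega) (ea a)
    (out a) r
  have hl := hp a (ea a).length (by simp)
  have e1 : (ea a).map (Equiv.refl Γ₀).invFun = ea a := List.map_id _
  have e2 : (eb (f a)).map (Equiv.refl Γ₁).invFun = (out a).map enc :=
    (List.map_id _).trans (hout a).symm
  refine ⟨⟨⟨h.steps, ?_⟩, h.steps_le_m.trans ?_⟩⟩
  · refine Eq.trans ?_ (h.evals_in_steps.trans ?_)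
    · exact congrArg (fun w => _^[h.steps] (some (initList (machine O (b + 1) dec enc Q) w))) e1
    · exact congrArg (fun w => some (haltList (machine O (b + 1) dec enc Q) w)) e2.symm
  · simp; omega

end Machine

section Output

/-- A bound on the number of symbols that a statement pushes. -/
def pushes {K : Type} {Γ : K → Type} {Λ σ : Type} : TM2.Stmt Γ Λ σ → ℕ
  | .push _ _ q => pushes q + 1
  | .peek _ _ q => pushes q
  | .pop _ _ q => pushes q
  | .load _ q => pushes q
  | .branch _ q q' => pushes q + pushes q'
  | .goto _ => 0
  | .halt => 0

theorem length_stepAux_le {K : Type} [DecidableEq K] {Γ : K → Type} {Λ σ : Type}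
    (q : TM2.Stmt Γ Λ σ) (v : σ) (S : ∀ k, List (Γ k)) (k : K) :
    ((TM2.stepAux q v S).stk k).length ≤ (S k).length + pushes q := by
  induction q generalizing v S with
  | push k' f q ih =>
    refine (ih _ _).trans ?_
    by_cases h : k = k'
    · subst h; simp [pushes]; omega
    · simp [pushes, h]
  | peek k' f q ih => exact ih _ _
  | pop k' f q ih =>
    refine (ih _ _).trans ?_
    by_cases h : k = k'
    · subst h; simp [pushes]
    · simp [pushes, h]
  | load f q ih => exact ih _ _
  | branch f q q' h h' =>
    simp only [TM2.stepAux, pushes]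
    cases f v
    · exact (h' _ _).trans (by omega)
    · exact (h _ _).trans (by omega)
  | goto f => simp [pushes]
  | halt => simp [pushes]

/-- The output is at most linearly longer than the input and the running time. -/
theorem exists_length_output_le (tm : FinTM2) : ∃ C : ℕ, ∀ w w' t,
    TM2OutputsInTime tm w (some w') t → w'.length ≤ w.length + C * t := by
  have := tm.ΛFin
  refine ⟨∑ l, pushes (tm.m l), fun w w' t h => ?_⟩
  have key : ∀ n (c c' : tm.Cfg), (flip bind tm.step)^[n] (some c) = some c' → ∀ k,
      (c'.stk k).length ≤ (c.stk k).length + (∑ l, pushes (tm.m l)) * n := by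
    intro n
    induction n with
    | zero =>
      intro c c' h k
      cases h
      simp
    | succ n ih =>
      intro c c' h k
      rw [iterate_succ_apply'] at h
      cases e : (flip bind tm.step)^[n] (some c) with
      | none => rw [e] at h; cases h
      | some d =>
        rw [e] at h
        refine le_trans ?_ ((Nat.add_le_add_right (ih c d e k) (∑ l, pushes (tm.m l))).trans
          (by rw [mul_add, mul_one, add_assoc]))
        rcases d with ⟨_ | l, v, s⟩
        · cases h
        · have h : some (TM2.stepAux (tm.m l) v s) = some c' := h
          cases h
          refine (length_stepAux_le _ _ _ _).trans (Nat.add_le_add_left ?_ _)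
          exact Finset.single_le_sum (f := fun l => pushes (tm.m l)) (fun _ _ => Nat.zero_le _)
            (Finset.mem_univ l)
  have h1 := key h.steps _ _ h.evals_in_steps tm.k₁
  rw [initList_stk, haltList_stk, update_self] at h1
  refine h1.trans (add_le_add ?_ (Nat.mul_le_mul_left _ h.steps_le_m))
  by_cases e : tm.k₁ = tm.k₀
  · rw [e] 
    simp
  · simp [e]

/-- The machine of a polynomial time computable function as an oracle. -/
def Oracle.ofPolyTime {α β Γ₀ Γ₁ : Type} {ea : α → List Γ₀} {eb : β → List Γ₁} {f : α → β}
    (h : TM2ComputableInPolyTime ea eb f) (dec : Sym → Γ₀) (enc : Γ₁ → Sym) : Oracle where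
  M := h.tm
  dec s := h.inputAlphabet.symm (dec s)
  enc s := enc (h.outputAlphabet s)

theorem PolyFun.call_polyTime {J : Type} {O : J → Oracle} {ι α β γ Γ₀ Γ₁ : Type}
    {v : ι → α → List Sym} {ea : β → List Γ₀} {eb : γ → List Γ₁} {f : β → γ}
    (h : TM2ComputableInPolyTime ea eb f) {dec : Sym → Γ₀} {enc : Γ₁ → Sym} (j : J)
    (hj : O j = .ofPolyTime h dec enc) {g : α → List Sym} (x : α → β) (hg : PolyFun O v g)
    (hx : ∀ a, (g a).map dec = ea (x a)) : PolyFun O v (fun a => (eb (f (x a))).map enc) := by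
  obtain ⟨C, hC⟩ := exists_length_output_le h.tm
  refine PolyFun.call j (.X + (.C C + 1) * h.time) hg fun a => ?_
  rw [hj]
  have e := h.outputsFun (x a)
  have e1 : (ea (x a)).length = (g a).length := by rw [← hx]; simp
  have e2 : (g a).map (Oracle.ofPolyTime h dec enc).dec =
      (ea (x a)).map h.inputAlphabet.invFun := by
    rw [← hx, List.map_map]; rfl
  have e3 := hC _ _ _ e
  simp only [List.length_map, e1] at e3
  refine ⟨(eb (f (x a))).map h.outputAlphabet.invFun, ?_, ?_, ?_⟩
  · refine List.map_map.trans (List.map_congr_left fun s _ => ?_)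
    exact congrArg enc (h.outputAlphabet.apply_symm_apply s)
  · refine (List.length_map _).trans_le ?_
    simp only [Polynomial.eval_add, Polynomial.eval_mul, Polynomial.eval_X, Polynomial.eval_C,
      Polynomial.eval_one]
    linarith [Nat.zero_le (h.time.eval (g a).length)]
  · rw [e2]
    refine ⟨⟨e.toEvalsTo, e.steps_le_m.trans ?_⟩⟩
    rw [e1]
    simp only [Polynomial.eval_add, Polynomial.eval_mul, Polynomial.eval_X, Polynomial.eval_C,
      Polynomial.eval_one]
    nlinarith [Nat.zero_le (h.time.eval (g a).length), Nat.zero_le C]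

end Output

/-! ### Unary arithmetic, bit strings and the direct power -/

section Derived

variable {J : Type} {O : J → Oracle} {ι α : Type} {v : ι → α → List Sym}

/-- A number in unary. -/
def unary (n : ℕ) : List Sym := List.replicate n (some true)

@[simp] theorem length_unary (n : ℕ) : (unary n).length = n := by simp [unary]

theorem unary_add (m n : ℕ) : unary (m + n) = unary m ++ unary n := by
  simp [unary]

theorem unary_injective : Injective unary := fun m n h => by
  simpa using congrArg List.length h

theorem PolyFun.fst {f : α → List Sym} (hf : PolyFun O v f) : PolyFun O (withCounter v)
    (fun b => f b.1) :=
  hf.comap some Prod.fst fun _ _ => rfl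

theorem PolyFun.snd : PolyFun O (withCounter v) (fun b => unary b.2) := PolyFun.var none

theorem PolyFun.range {n : α → ℕ} {h : α → ℕ → List Sym} (hn : PolyFun O v fun a => unary (n a))
    (hh : PolyFun O (withCounter v) fun b => h b.1 b.2) :
    PolyFun O v (fun a => (List.range (n a)).flatMap (h a)) :=
  (hn.flatMap hh).congr fun a => by simp

theorem flatMap_const_unary (l : List ℕ) (n : ℕ) :
    l.flatMap (fun _ => unary n) = unary (l.length * n) := by
  induction l with
  | nil => simp [unary]
  | cons a l ih => simp [ih, add_mul, unary_add, add_comm]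

theorem PolyFun.length {f : α → List Sym} (hf : PolyFun O v f) : PolyFun O v
    (fun a => unary (f a).length) :=
  (hf.flatMap (h := fun _ _ => unary 1) (PolyFun.const _)).congr fun a => by
    simp [flatMap_const_unary]

theorem PolyFun.mul {m n : α → ℕ} (hm : PolyFun O v fun a => unary (m a))
    (hn : PolyFun O v fun a => unary (n a)) : PolyFun O v fun a => unary (m a * n a) :=
  (hm.range (h := fun a _ => unary (n a)) hn.fst).congr fun a => by simp [flatMap_const_unary]

theorem PolyFun.add {m n : α → ℕ} (hm : PolyFun O v fun a => unary (m a))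
    (hn : PolyFun O v fun a => unary (n a)) : PolyFun O v fun a => unary (m a + n a) :=
  (hm.append hn).congr fun a => by simp [unary_add]

theorem PolyFun.pow {m : α → ℕ} (hm : PolyFun O v fun a => unary (m a)) (k : ℕ) :
    PolyFun O v fun a => unary (m a ^ k) := by
  induction k with
  | zero => exact (PolyFun.const (unary 1)).congr fun a => by simp
  | succ k ih => exact (ih.mul hm).congr fun a => by simp [pow_succ]

theorem PolyFun.poly {m : α → ℕ} (hm : PolyFun O v fun a => unary (m a)) (p : Polynomial ℕ) :
    PolyFun O v fun a => unary (p.eval (m a)) := by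
  induction p using Polynomial.induction_on' with
  | add p q hp hq => exact (hp.add hq).congr fun a => by simp
  | monomial n c => exact ((PolyFun.const (unary c)).mul (hm.pow n)).congr fun a => by simp

theorem PolyFun.drop {n : α → ℕ} {f : α → List Sym} (hn : PolyFun O v fun a => unary (n a))
    (hf : PolyFun O v f) : PolyFun O v fun a => (f a).drop (n a) :=
  (PolyFun.binop .drop hn hf).congr fun a => by simp

theorem PolyFun.take {n : α → ℕ} {f : α → List Sym} (hn : PolyFun O v fun a => unary (n a))
    (hf : PolyFun O v f) : PolyFun O v fun a => (f a).take (n a) :=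
  (PolyFun.binop .take hn hf).congr fun a => by simp

theorem PolyFun.ite_eq {f g h k : α → List Sym} (hf : PolyFun O v f) (hg : PolyFun O v g)
    (hh : PolyFun O v h)
    (hk : PolyFun O v k) : PolyFun O v fun a => if f a = g a then h a else k a :=
  ((PolyFun.binop .mismatch hf hg).ite hh hk).congr fun a => by simp [mismatch_eq_nil]

theorem PolyFun.ite_nat {m n : α → ℕ} {h k : α → List Sym} (hm : PolyFun O v fun a => unary (m a))
    (hn : PolyFun O v fun a => unary (n a)) (hh : PolyFun O v h)
    (hk : PolyFun O v k) : PolyFun O v fun a => if m a = n a then h a else k a :=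
  (hm.ite_eq hn hh hk).congr fun a => by simp [unary_injective.eq_iff]

theorem PolyFun.ite_le {m n : α → ℕ} {h k : α → List Sym} (hm : PolyFun O v fun a => unary (m a))
    (hn : PolyFun O v fun a => unary (n a)) (hh : PolyFun O v h)
    (hk : PolyFun O v k) : PolyFun O v fun a => if m a ≤ n a then h a else k a :=
  ((hn.drop hm).ite hh hk).congr fun a => by
    simp only [unary, List.drop_replicate, List.replicate_eq_nil_iff, Nat.sub_eq_zero_iff_le]

/-- A bit string as a word over `Sym`. -/
def bits (x : List Bool) : List Sym := x.map some

theorem bits_injective : Injective bits := List.map_injective_iff.2 (Option.some_injective _)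

@[simp] theorem length_bits (x : List Bool) : (bits x).length = x.length := by simp [bits]

theorem bits_append (x y : List Bool) : bits (x ++ y) = bits x ++ bits y := by simp [bits]

theorem PolyFun.bits_append {x y : α → List Bool} (hx : PolyFun O v fun a => bits (x a))
    (hy : PolyFun O v fun a => bits (y a)) : PolyFun O v fun a => bits (x a ++ y a) :=
  (hx.append hy).congr fun a => by simp [bits]

theorem PolyFun.bits_drop {n : α → ℕ} {x : α → List Bool} (hn : PolyFun O v fun a => unary (n a))
    (hx : PolyFun O v fun a => bits (x a)) : PolyFun O v fun a => bits ((x a).drop (n a)) :=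
  (hn.drop hx).congr fun a => by simp [bits]

theorem PolyFun.bits_take {n : α → ℕ} {x : α → List Bool} (hn : PolyFun O v fun a => unary (n a))
    (hx : PolyFun O v fun a => bits (x a)) : PolyFun O v fun a => bits ((x a).take (n a)) :=
  (hn.take hx).congr fun a => by simp [bits]

theorem PolyFun.bits_range {n : α → ℕ} {h : α → ℕ → List Bool}
    (hn : PolyFun O v fun a => unary (n a))
    (hh : PolyFun O (withCounter v) fun b => bits (h b.1 b.2)) :
    PolyFun O v (fun a => bits ((List.range (n a)).flatMap (h a))) :=
  (hn.range (h := fun a j => bits (h a j)) hh).congr fun a => by simp [bits, List.map_flatMap]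

theorem flatMap_range_drop_take {β γ : Type*} (x : List β) (f : β → List γ) (g : List β → List γ)
    (hg : ∀ b, g [b] = f b) :
    (List.range x.length).flatMap (fun j => g ((x.drop j).take 1)) = x.flatMap f := by
  induction x with
  | nil => simp
  | cons b x ih =>
    simp [List.range_succ_eq_map, List.flatMap_map, ih, hg]

theorem PolyFun.encodeBlock {x : α → List Bool} (hx : PolyFun O v fun a => bits (x a)) :
    PolyFun O v fun a => bits (encodeBlock (x a)) := by
  have h := ((hx.length.range (h := fun a j => [some true] ++ bits (((x a).drop j).take 1))
    ((PolyFun.const [some true]).append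
      ((PolyFun.const (unary 1)).bits_take (PolyFun.snd.bits_drop hx.fst)))).append
          (PolyFun.const [some false]))
  refine h.congr fun a => ?_
  rw [length_bits, flatMap_range_drop_take (x a) (fun b => [some true, some b])
    (fun y => [some true] ++ bits y) (fun b => rfl)]
  simp [OneWay.encodeBlock, bits, List.map_flatMap]

variable (O) in
/-- Programs can apply `F` to the value of a polynomial time function. -/
def Callable (F : List Bool → List Bool) : Prop :=
  ∀ (ι α : Type) (v : ι → α → List Sym) (x : α → List Bool), PolyFun O v (fun a => bits (x a)) →
    PolyFun O v fun a => bits (F (x a))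

/-- `(F(x₀), …, y, …, F(x_{t-1}))` as one string, with `y` at position `i₀`, where the `xᵢ` are the
blocks of length `n` of `w`. There is no `y` if `i₀ ≥ t`. -/
def blocksWith (F : List Bool → List Bool) (n t i₀ : ℕ) (y w : List Bool) : List Bool :=
  (List.range t).flatMap fun i => encodeBlock (if i = i₀ then y else F ((w.drop (i * n)).take n))

theorem powerBlocks_eq (F : List Bool → List Bool) (n t : ℕ) (x : List Bool) :
    powerBlocks F n t x = blocksWith F n t t [] x := by
  rw [powerBlocks, encodeTuple, List.flatMap_map, blocksWith]
  refine List.flatMap_congr fun i hi => ?_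
  rw [if_neg (by simp at hi; omega)]

theorem PolyFun.blocksWith {F : List Bool → List Bool} (hF : Callable O F) {n t i₀ : α → ℕ}
    {y w : α → List Bool} (hn : PolyFun O v fun a => unary (n a))
        (ht : PolyFun O v fun a => unary (t a))
    (hi : PolyFun O v fun a => unary (i₀ a)) (hy : PolyFun O v fun a => bits (y a))
    (hw : PolyFun O v fun a => bits (w a)) :
    PolyFun O v fun a => bits (blocksWith F (n a) (t a) (i₀ a) (y a) (w a)) := by
  refine ht.bits_range (PolyFun.encodeBlock ?_)
  refine (PolyFun.snd.ite_nat hi.fst hy.fst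
    (hF _ _ _ _ (hn.fst.bits_take ((PolyFun.snd.mul hn.fst).bits_drop hw.fst)))).congr fun b => ?_
  split_ifs <;> rfl

theorem flatMap_range_ite_lt (m N : ℕ) : (List.range N).flatMap (fun j => if j < m then
    unary 1 else []) = unary (min m N) := by
  induction N with
  | zero => simp [unary]
  | succ N ih =>
    rw [List.range_succ, List.flatMap_append, ih, List.flatMap_singleton]
    split_ifs with h
    · rw [← unary_add]; congr 1; omega
    · rw [List.append_nil]; congr 1; omega

theorem le_blockLength_iff {t : ℕ → ℕ} (ht : Monotone t) {N j : ℕ} (hj : j ≤ N) :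
    j ≤ blockLength t N ↔ j * t j ≤ N := by
  constructor
  · intro h
    have : blockLength t N * t (blockLength t N) ≤ N :=
      Nat.findGreatest_spec (P := fun n => n * t n ≤ N) (Nat.zero_le N) (by simp)
    exact (Nat.mul_le_mul h (ht h)).trans this
  · exact fun h => Nat.le_findGreatest hj h

theorem PolyFun.blockLength {N : α → ℕ} (hN : PolyFun O v fun a => unary (N a)) (k : ℕ) :
    PolyFun O v fun a => unary (blockLength (fun n => n ^ k) (N a)) := by
  -- The block length is the number of `j < N` such that `j + 1` is at most the block length.
  have h := hN.range (h := fun a j => if (j + 1) * (j + 1) ^ k ≤ N a then unary 1 else [])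
    (PolyFun.ite_le ((PolyFun.snd.add (PolyFun.const (unary 1))).mul
        ((PolyFun.snd.add (PolyFun.const (unary 1))).pow k))
      hN.fst (PolyFun.const _) (PolyFun.const _))
  refine h.congr fun a => ?_
  have hle : OneWay.blockLength (fun n => n ^ k) (N a) ≤ N a := Nat.findGreatest_le _
  rw [← min_eq_left hle, ← flatMap_range_ite_lt]
  refine List.flatMap_congr fun j hj => ?_
  have := le_blockLength_iff (t := fun n => n ^ k) (fun a b h => Nat.pow_le_pow_left h k)
    (N := N a) (j := j + 1) (by simpa using hj)
  simp only [← this, Nat.succ_le_iff]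

theorem PolyFun.directPower {F : List Bool → List Bool} (hF : Callable O F) {x : α → List Bool}
    (hx : PolyFun O v fun a => bits (x a)) (k : ℕ) :
    PolyFun O v fun a => bits (directPower F (fun n => n ^ k) (x a)) := by
  have hN : PolyFun O v fun a => unary (x a).length := hx.length.congr fun a => by simp
  have hn := hN.blockLength k
  have ht := hn.pow k
  refine ((PolyFun.blocksWith hF hn ht ht (PolyFun.const (bits []))
      ((hn.mul ht).bits_take hx)).bits_append
    ((hn.mul ht).bits_drop hx)).congr fun a => ?_
  rw [← powerBlocks_eq]
  rfl

theorem PolyTimeComputable.directPower {F : List Bool → List Bool} (hF : PolyTimeComputable F)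
    (k : ℕ) : PolyTimeComputable (directPower F fun n => n ^ k) := by
  obtain ⟨h⟩ := hF
  have hc : Callable (fun _ : Unit => .ofPolyTime h (fun s => s.getD false) some) F :=
    fun ι α v x hx => PolyFun.call_polyTime h () rfl x hx fun a => by simp [bits]
  exact PolyFun.tm2Computable some (fun s => s.getD false)
      (PolyFun.directPower hc (PolyFun.var ()) k)
    fun a => by simp [bits]

end Derived

/-! ### The adversary built from an inverter of the direct power -/

section Parse

/-- The part of `w` between its `k`-th and `k + 1`-st separator. -/
def segment (k : ℕ) (w : List Sym) : List Sym :=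
  (List.range w.length).flatMap fun j =>
    if (w.drop j).take 1 = [none] then [] else
      if (w.take j).count none = k then (w.drop j).take 1 else []

theorem segment_some_cons (k : ℕ) (b : Bool) (w : List Sym) :
    segment k (some b :: w) = (if k = 0 then [some b] else []) ++ segment k w := by
  simp [segment, List.range_succ_eq_map, List.flatMap_map, eq_comm]

theorem segment_none_cons_succ (k : ℕ) (w : List Sym) : segment (k + 1) (none :: w) =
    segment k w := by
  simp [segment, List.range_succ_eq_map, List.flatMap_map]

theorem segment_none_cons_zero (w : List Sym) : segment 0 (none :: w) = [] := by
  simp [segment, List.range_succ_eq_map, List.flatMap_map]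

theorem segment_zero_bits (x : List Bool) : segment 0 (bits x) = bits x := by
  induction x with
  | nil => rfl
  | cons b x ih =>
    have : bits (b :: x) = some b :: bits x := rfl
    rw [this, segment_some_cons, ih]
    simp

theorem segment_zero_append (x : List Bool) (w : List Sym) :
    segment 0 (bits x ++ none :: w) = bits x := by
  induction x with
  | nil => exact segment_none_cons_zero w
  | cons b x ih =>
    have : bits (b :: x) = some b :: bits x := rfl
    rw [this, List.cons_append, segment_some_cons, ih]
    simp

theorem segment_succ_append (k : ℕ) (x : List Bool) (w : List Sym) :
    segment (k + 1) (bits x ++ none :: w) = segment k w := by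
  induction x with
  | nil => exact segment_none_cons_succ k w
  | cons b x ih =>
    have : bits (b :: x) = some b :: bits x := rfl
    rw [this, List.cons_append, segment_some_cons, ih]
    simp

theorem encodeTriple_eq (a : ℕ × List Bool × List Bool) :
    encodeTriple a = bits (List.replicate a.1 true) ++ none ::
        (bits a.2.1 ++ none :: bits a.2.2) := by
  simp [encodeTriple, bits]

variable {J : Type} {O : J → Oracle} {ι α : Type} {v : ι → α → List Sym}

theorem PolyFun.count_none {f : α → List Sym} (hf : PolyFun O v f) :
    PolyFun O v fun a => unary ((f a).count none) := by
  refine (hf.flatMap (h := fun a j => if ((f a).drop j).take 1 = [none] then unary 1 else [])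
    (PolyFun.ite_eq (PolyFun.take (PolyFun.const (unary 1)) (PolyFun.drop PolyFun.snd hf.fst))
        (PolyFun.const _)
      (PolyFun.const _) (PolyFun.const _))).congr fun a => ?_
  generalize f a = l
  rw [flatMap_range_drop_take l (fun s => if s = none then unary 1 else [])
    (fun l => if l = [none] then unary 1 else []) (fun s => by simp)]
  induction l with
  | nil => rfl
  | cons s l ih =>
    rw [List.flatMap_cons, ih, List.count_cons]
    cases s
    · simp [← unary_add, add_comm]
    · simp

theorem PolyFun.segment {f : α → List Sym} (hf : PolyFun O v f) (k : ℕ) :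
    PolyFun O v fun a => segment k (f a) := by
  have h1 : PolyFun O (withCounter v) fun b => ((f b.1).drop b.2).take 1 :=
    PolyFun.take (PolyFun.const (unary 1)) (PolyFun.drop PolyFun.snd hf.fst)
  exact hf.flatMap (h := fun a j => if ((f a).drop j).take 1 = [none] then [] else
      if ((f a).take j).count none = k then ((f a).drop j).take 1 else [])
    (h1.ite_eq (PolyFun.const _) (PolyFun.const _)
        ((PolyFun.take PolyFun.snd hf.fst).count_none.ite_nat
      (PolyFun.const (unary k)) h1 (PolyFun.const _)))

variable {x : α → ℕ × List Bool × List Bool}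

theorem PolyFun.encodeTriple_fst (h : PolyFun O v fun a => encodeTriple (x a)) :
    PolyFun O v fun a => unary (x a).1 :=
  (h.segment 0).congr fun a => by
    rw [encodeTriple_eq, segment_zero_append]
    simp [bits, unary]

theorem PolyFun.encodeTriple_snd (h : PolyFun O v fun a => encodeTriple (x a)) :
    PolyFun O v fun a => bits (x a).2.1 :=
  (h.segment 1).congr fun a => by
    rw [encodeTriple_eq, segment_succ_append, segment_zero_append]

theorem PolyFun.encodeTriple_thd (h : PolyFun O v fun a => encodeTriple (x a)) :
    PolyFun O v fun a => bits (x a).2.2 :=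
  (h.segment 2).congr fun a => by
    rw [encodeTriple_eq, segment_succ_append, segment_succ_append, segment_zero_bits]

theorem PolyFun.encodeTriple (h1 : PolyFun O v fun a => unary (x a).1)
    (h2 : PolyFun O v fun a => bits (x a).2.1)
    (h3 : PolyFun O v fun a => bits (x a).2.2) : PolyFun O v fun a => encodeTriple (x a) :=
  (h1.append ((PolyFun.const [none]).append (h2.append ((PolyFun.const [none]).append h3)))).congr
    fun a => by simp [OneWay.encodeTriple, bits, unary]

end Parse

section Adversary

variable (F : List Bool → List Bool) (A : PPT) (T M L K : Polynomial ℕ)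

/-- The string that the adversary, on input `a = (n, y, r)`, tries as a preimage of `y`, with the
`j`-th chunk of random bits, for length `N` and position `i`. The first `N` bits of the chunk make
up a random input of the direct power, and the next ones are the random bits for `A`. The offset `1`
skips the marker `1` of `encodePartial`; if `A` is undefined, the candidate is too short. The values
of the polynomials `T` and `L` at `n` are the number of blocks and the length of a chunk. -/
def candidate (a : ℕ × List Bool × List Bool) (j N i : ℕ) : List Bool :=
  ((encodePartial (A.G (N,
    blocksWith F a.1 (T.eval a.1) i a.2.1 ((a.2.2.drop (j * L.eval a.1)).take N) ++
      ((a.2.2.drop (j * L.eval a.1)).take N).drop (a.1 * T.eval a.1),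
    ((a.2.2.drop (j * L.eval a.1)).drop N).take (A.q.eval N)))).drop (1 + i * a.1)).take a.1

/-- `x` is a preimage of `y` of length `n`, where `a = (n, y, r)`. -/
def IsPreimage (a : ℕ × List Bool × List Bool) (x : List Bool) : Prop :=
  x.length = a.1 ∧ F x = a.2.1

instance (a : ℕ × List Bool × List Bool) (x : List Bool) : Decidable (IsPreimage F a x) :=
  inferInstanceAs (Decidable (_ ∧ _))

/-- All preimages found among the candidates. The values of the polynomials `K`, `M` and `T` at `n`
bound the number of the chunk, the length and the position. -/
def preimages (a : ℕ × List Bool × List Bool) : List (List Bool) :=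
  (List.range (K.eval a.1)).flatMap fun j => (List.range (M.eval a.1)).flatMap fun N =>
    (List.range (T.eval a.1)).flatMap fun i =>
      if IsPreimage F a (candidate F A T L a j N i) then [candidate F A T L a j N i] else []

variable {F A T M L K}

theorem mem_preimages {a : ℕ × List Bool × List Bool} {x : List Bool} :
    x ∈ preimages F A T M L K a ↔ IsPreimage F a x ∧ ∃ j < K.eval a.1, ∃ N < M.eval a.1,
      ∃ i < T.eval a.1, x = candidate F A T L a j N i := by
  simp only [preimages, List.mem_flatMap, List.mem_range, List.mem_ite_nil_right,
    List.mem_singleton]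
  constructor
  · rintro ⟨j, hj, N, hN, i, hi, h, rfl⟩
    exact ⟨h, j, hj, N, hN, i, hi, rfl⟩
  · rintro ⟨h, j, hj, N, hN, i, hi, rfl⟩
    exact ⟨j, hj, N, hN, i, hi, h, rfl⟩

/-- Finding the first element needs no search: it is a prefix of known length of the concatenation.
-/
theorem encodePartial_head? {n : ℕ} {l : List (List Bool)} (hl : ∀ x ∈ l, x.length = n) :
    (l.flatMap (true :: ·)).take (n + 1) = encodePartial l.head? := by
  cases l with
  | nil => rfl
  | cons x l =>
    have : x.length = n := hl x (by simp)
    simp [encodePartial, this]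

variable {J : Type} {O : J → Oracle} {ι α : Type} {v : ι → α → List Sym}
  {x : α → ℕ × List Bool × List Bool}

variable (O) in
/-- Programs can apply the partial function `G` to the value of a polynomial time function. -/
def CallablePartial (G : ℕ × List Bool × List Bool → Option (List Bool)) : Prop :=
  ∀ (ι α : Type) (v : ι → α → List Sym) (x : α → ℕ × List Bool × List Bool),
    PolyFun O v (fun a => encodeTriple (x a)) → PolyFun O v fun a => bits (encodePartial (G (x a)))

theorem PolyFun.candidate (hF : Callable O F) (hA : CallablePartial O A.G)
    (hx : PolyFun O v fun a => OneWay.encodeTriple (x a)) {j N i : α → ℕ}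
        (hj : PolyFun O v fun a => unary (j a))
    (hN : PolyFun O v fun a => unary (N a)) (hi : PolyFun O v fun a => unary (i a)) :
    PolyFun O v fun a => bits (candidate F A T L (x a) (j a) (N a) (i a)) := by
  have hn := hx.encodeTriple_fst
  have hy := hx.encodeTriple_snd
  have hr := (hj.mul (hn.poly L)).bits_drop hx.encodeTriple_thd
  have hw := hN.bits_take hr
  have ht := hn.poly T
  exact hn.bits_take (((PolyFun.const (unary 1)).add (hi.mul hn)).bits_drop (hA _ _ _ _
    (PolyFun.encodeTriple hN ((PolyFun.blocksWith hF hn ht hi hy hw).bits_append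
      ((hn.mul ht).bits_drop hw)) ((hN.poly A.q).bits_take (hN.bits_drop hr)))))

theorem PolyFun.preimages (hF : Callable O F) (hA : CallablePartial O A.G)
    (hx : PolyFun O v fun a => OneWay.encodeTriple (x a)) :
    PolyFun O v fun a => bits (encodePartial (preimages F A T M L K (x a)).head?) := by
  have hn := hx.encodeTriple_fst
  have hy := hx.encodeTriple_snd
  have hc : PolyFun O (withCounter (withCounter (withCounter v))) fun b => bits
      (OneWay.candidate F A T L (x b.1.1.1)
      b.1.1.2 b.1.2 b.2) :=
    PolyFun.candidate hF hA hx.fst.fst.fst PolyFun.snd.fst.fst PolyFun.snd.fst PolyFun.snd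
  have hl : PolyFun O (withCounter (withCounter (withCounter v))) fun b => unary
      (OneWay.candidate F A T L (x b.1.1.1)
      b.1.1.2 b.1.2 b.2).length := hc.length.congr fun b => by simp
  have h := (hn.add (PolyFun.const (unary 1))).bits_take <| PolyFun.bits_range (hn.poly K)
    (h := fun a j => (List.range (M.eval (x a).1)).flatMap fun N =>
      (List.range (T.eval (x a).1)).flatMap fun i =>
        if (OneWay.candidate F A T L (x a) j N i).length = (x a).1 then
          if F (OneWay.candidate F A T L (x a) j N i) = (x a).2.1 then
            [true] ++ OneWay.candidate F A T L (x a) j N i else [] else []) <|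
    PolyFun.bits_range (hn.fst.poly M)
      (h := fun b N => (List.range (T.eval (x b.1).1)).flatMap fun i =>
        if (OneWay.candidate F A T L (x b.1) b.2 N i).length = (x b.1).1 then
          if F (OneWay.candidate F A T L (x b.1) b.2 N i) = (x b.1).2.1 then
            [true] ++ OneWay.candidate F A T L (x b.1) b.2 N i else [] else []) <|
    PolyFun.bits_range (hn.fst.fst.poly T)
      (h := fun b i => if (OneWay.candidate F A T L (x b.1.1) b.1.2 b.2 i).length = (x b.1.1).1 then
          if F (OneWay.candidate F A T L (x b.1.1) b.1.2 b.2 i) = (x b.1.1).2.1 then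
            [true] ++ OneWay.candidate F A T L (x b.1.1) b.1.2 b.2 i else [] else []) <|
    (hl.ite_nat hn.fst.fst.fst ((hF _ _ _ _ hc).ite_eq hy.fst.fst.fst
      ((PolyFun.const (bits [true])).bits_append hc) (PolyFun.const (bits [])))
          (PolyFun.const (bits []))).congr
      fun b => by simp only [bits_injective.eq_iff]; split_ifs <;> rfl
  refine h.congr fun a => ?_
  rw [← encodePartial_head? (fun y hy => (mem_preimages.1 hy).1.1), OneWay.preimages]
  simp only [List.flatMap_assoc]
  congr 2
  refine List.flatMap_congr fun j _ => List.flatMap_congr fun N _ =>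
    List.flatMap_congr fun i _ => ?_
  by_cases h1 : (OneWay.candidate F A T L (x a) j N i).length = (x a).1 <;>
  by_cases h2 : F (OneWay.candidate F A T L (x a) j N i) = (x a).2.1 <;>
  simp [IsPreimage, h1, h2]

variable (A T M L K) in
/-- The adversary that answers with the first preimage found. -/
theorem exists_ppt (hF : PolyTimeComputable F) (q : Polynomial ℕ) :
    ∃ B : PPT, B.q = q ∧ ∀ a, B.G a = (preimages F A T M L K a).head? := by
  obtain ⟨h⟩ := hF
  obtain ⟨h'⟩ := A.polyTime
  set O : Bool → Oracle := fun j => match j with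
    | false => .ofPolyTime h (fun s => s.getD false) some
    | true => .ofPolyTime h' id some with hO
  have hc : Callable O F := fun ι α v x hx => PolyFun.call_polyTime h false rfl x hx fun a => by
    simp [bits]
  have hc' : CallablePartial O A.G :=
    fun ι α v x hx => PolyFun.call_polyTime h' true rfl x hx fun a => by simp
  refine ⟨⟨fun a => (preimages F A T M L K a).head?, q, ?_⟩, rfl, fun a => rfl⟩
  refine PolyFun.tm2Computable id (fun s => s.getD false)
      (PolyFun.preimages (A := A) (T := T) (M := M) (L := L)
    (K := K) (x := id) hc hc' ((PolyFun.var ()).congr fun a => by simp)) fun a => by simp [bits]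

end Adversary

/-! ### Averages over bit strings and the success probability -/

section Average

/-- The average of `f` over the bit strings of length `n`. -/
noncomputable def avg : ℕ → (List Bool → ℝ) → ℝ
  | 0, f => f []
  | n + 1, f => (avg n (fun x => f (true :: x)) + avg n fun x => f (false :: x)) / 2

theorem avg_append (m n : ℕ) (f : List Bool → ℝ) :
    avg (m + n) f = avg m fun x => avg n fun y => f (x ++ y) := by
  induction m generalizing f with
  | zero => simp [avg]
  | succ m ih =>
    rw [show m + 1 + n = m + n + 1 by ring]
    simp [avg, ih]

theorem avg_mono {n : ℕ} {f g : List Bool → ℝ} (h : ∀ x, x.length = n → f x ≤ g x) :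
    avg n f ≤ avg n g := by
  induction n generalizing f g with
  | zero => exact h [] rfl
  | succ n ih =>
    have h1 := ih (f := fun x => f (true :: x)) (g := fun x => g (true :: x))
      fun x hx => h _ (by simp [hx])
    have h2 := ih (f := fun x => f (false :: x)) (g := fun x => g (false :: x))
      fun x hx => h _ (by simp [hx])
    simp only [avg]
    linarith

theorem avg_congr {n : ℕ} {f g : List Bool → ℝ} (h : ∀ x, x.length = n → f x = g x) :
    avg n f = avg n g :=
  le_antisymm (avg_mono fun x hx => (h x hx).le) (avg_mono fun x hx => (h x hx).ge)

@[simp] theorem avg_const (n : ℕ) (c : ℝ) : avg n (fun _ => c) = c := by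
  induction n with
  | zero => rfl
  | succ n ih => simp [avg, ih]

theorem avg_add (n : ℕ) (f g : List Bool → ℝ) :
    avg n (fun x => f x + g x) = avg n f + avg n g := by
  induction n generalizing f g with
  | zero => rfl
  | succ n ih => simp only [avg, ih]; ring

theorem avg_mul_right (n : ℕ) (f : List Bool → ℝ) (c : ℝ) :
    avg n (fun x => f x * c) = avg n f * c := by
  induction n generalizing f with
  | zero => rfl
  | succ n ih => simp only [avg, ih]; ring

theorem avg_mul_left (n : ℕ) (f : List Bool → ℝ) (c : ℝ) :
    avg n (fun x => c * f x) = c * avg n f := by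
  simp only [mul_comm c, avg_mul_right]

theorem avg_one_sub (n : ℕ) (f : List Bool → ℝ) :
    avg n (fun x => 1 - f x) = 1 - avg n f := by
  have := avg_add n (fun x => 1 - f x) f
  simp only [sub_add_cancel, avg_const] at this
  linarith

theorem avg_sum {κ : Type*} (s : Finset κ) (n : ℕ) (f : κ → List Bool → ℝ) :
    avg n (fun x => ∑ i ∈ s, f i x) = ∑ i ∈ s, avg n (f i) := by
  classical
  induction s using Finset.induction_on with
  | empty => simp
  | insert a s ha ih => simp only [Finset.sum_insert ha, avg_add, ih]

/-- Fubini's theorem. -/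
theorem avg_comm (m n : ℕ) (f : List Bool → List Bool → ℝ) :
    avg m (fun x => avg n fun y => f x y) = avg n fun y => avg m fun x => f x y := by
  induction m generalizing f with
  | zero => rfl
  | succ m ih =>
    simp only [avg, ih]
    simp only [div_eq_mul_inv, avg_mul_right, avg_add]

theorem sum_vector (n : ℕ) (f : List Bool → ℝ) :
    ∑ x : List.Vector Bool n, f x.toList = 2 ^ n * avg n f := by
  induction n generalizing f with
  | zero =>
    rw [Fintype.sum_eq_single List.Vector.nil (fun x hx => absurd (Subsingleton.elim x _) hx)]
    simp [avg]
  | succ n ih =>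
    let e : List.Vector Bool (n + 1) ≃ Bool × List.Vector Bool n :=
      ⟨fun x => (x.head, x.tail), fun p => p.1 ::ᵥ p.2, fun x => by simp, fun p => by simp⟩
    rw [← e.symm.sum_comp, Fintype.sum_prod_type, Fintype.sum_bool]
    have h1 := ih fun x => f (true :: x)
    have h2 := ih fun x => f (false :: x)
    simp only [e, Equiv.coe_fn_symm_mk, List.Vector.toList_cons, h1, h2, avg]
    ring

open Classical in
/-- The indicator of a proposition, as a real number. -/
noncomputable def ind (p : Prop) : ℝ := if p then 1 else 0

theorem ind_nonneg (p : Prop) : 0 ≤ ind p := by unfold ind; split_ifs <;> norm_num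

theorem ind_le_one (p : Prop) : ind p ≤ 1 := by unfold ind; split_ifs <;> norm_num

theorem ind_of {p : Prop} (h : p) : ind p = 1 := if_pos h

theorem ind_of_not {p : Prop} (h : ¬p) : ind p = 0 := if_neg h

theorem avg_nonneg {n : ℕ} {f : List Bool → ℝ} (h : ∀ x, 0 ≤ f x) : 0 ≤ avg n f := by
  simpa using avg_mono (n := n) fun x _ => h x

theorem avg_le_one {n : ℕ} {f : List Bool → ℝ} (h : ∀ x, f x ≤ 1) : avg n f ≤ 1 := by
  simpa using avg_mono (n := n) fun x _ => h x

theorem invertProb_eq_avg (F : List Bool → List Bool) (A : PPT) (n : ℕ) :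
    invertProb F A n = avg n fun x => avg (A.q.eval n) fun r =>
      ind ((A.G (n, F x, r)).map (aux F) = some (n, F x)) := by
  classical
  rw [invertProb, Fintype.card_prod, card_vector, card_vector, Fintype.card_bool,
    Fintype.card_subtype, Finset.card_filter]
  push_cast
  rw [Fintype.sum_prod_type, div_eq_iff (by positivity)]
  have h1 : ∀ x : List.Vector Bool n, (∑ r : List.Vector Bool (A.q.eval n),
      if (A.G (n, F x.toList, r.toList)).map (aux F) = some (n, F x.toList) then (1 : ℝ) else 0) =
      2 ^ A.q.eval n * avg (A.q.eval n) fun r =>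
        ind ((A.G (n, F x.toList, r)).map (aux F) = some (n, F x.toList)) := by
    intro x
    rw [← sum_vector]
    refine Finset.sum_congr rfl fun r _ => ?_
    unfold ind
    congr
  simp only [h1]
  rw [← Finset.mul_sum, sum_vector n fun x => avg (A.q.eval n) fun r =>
    ind ((A.G (n, F x, r)).map (aux F) = some (n, F x))]
  ring

end Average

section Blocks

/-- The `i`-th block of length `n` of `w`. -/
def block (n i : ℕ) (w : List Bool) : List Bool := (w.drop (i * n)).take n

/-- Replaces the `i`-th block of length `n` of `w` by `x`. -/
def setBlock (n i : ℕ) (w x : List Bool) : List Bool :=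
  w.take (i * n) ++ x ++ w.drop ((i + 1) * n)

theorem length_block {n i : ℕ} {w : List Bool} (h : (i + 1) * n ≤ w.length) :
    (block n i w).length = n := by
  have : (i + 1) * n = i * n + n := by ring
  simp [block]; omega

theorem length_setBlock {n i : ℕ} {w x : List Bool} (h : (i + 1) * n ≤ w.length)
    (hx : x.length = n) : (setBlock n i w x).length = w.length := by
  have : (i + 1) * n = i * n + n := by ring
  simp [setBlock]; omega

theorem block_setBlock_self {n i : ℕ} {w x : List Bool} (h : (i + 1) * n ≤ w.length)
    (hx : x.length = n) : block n i (setBlock n i w x) = x := by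
  have : (i + 1) * n = i * n + n := by ring
  have h1 : (w.take (i * n)).length = i * n := by simp; omega
  rw [block, setBlock, List.append_assoc, List.drop_append_of_le_length (by omega),
    List.drop_of_length_le (by omega), List.nil_append, List.take_append_of_le_length (by omega),
    List.take_of_length_le (by omega)]

theorem drop_setBlock {n i m : ℕ} {w x : List Bool} (h : (i + 1) * n ≤ w.length)
    (hx : x.length = n) (hm : (i + 1) * n ≤ m) : (setBlock n i w x).drop m = w.drop m := by
  have e : (i + 1) * n = i * n + n := by ring
  have h1 : (w.take (i * n) ++ x).length = (i + 1) * n := by simp; omega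
  rw [setBlock, List.drop_append, List.drop_of_length_le (by omega), List.nil_append,
    List.drop_drop, h1]
  congr 1
  omega

theorem block_setBlock_of_ne {n i j : ℕ} {w x : List Bool} (h : (i + 1) * n ≤ w.length)
    (hx : x.length = n) (hij : j ≠ i) : block n j (setBlock n i w x) = block n j w := by
  rcases Nat.lt_or_gt_of_ne hij with hlt | hlt
  · have h2 : (j + 1) * n ≤ i * n := Nat.mul_le_mul_right _ hlt
    have e : (j + 1) * n = j * n + n := by ring
    have e : (i + 1) * n = i * n + n := by ring
    rw [block, block, setBlock, List.append_assoc, List.drop_append_of_le_length (by simp; omega),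
      List.take_append_of_le_length (by simp; omega), List.drop_take, List.take_take]
    congr 1
    omega
  · rw [block, block, drop_setBlock h hx (Nat.mul_le_mul_right _ hlt)]

/-- A random string remains so when one of its blocks is chosen anew. -/
theorem avg_block_setBlock {n t N i : ℕ} (hi : i < t) (hN : n * t ≤ N) (f : List Bool → ℝ) :
    avg N f = avg n fun x => avg N fun w => f (setBlock n i w x) := by
  have h1 : (i + 1) * n ≤ N := (Nat.mul_le_mul_right n hi).trans (by rwa [mul_comm])
  have e : (i + 1) * n = i * n + n := by ring
  obtain ⟨z, rfl⟩ := Nat.exists_eq_add_of_le h1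
  rw [e, add_assoc]
  simp only [avg_append (i * n), avg_append n]
  rw [avg_comm]
  refine avg_congr fun x hx => avg_congr fun u hu => ?_
  rw [← avg_const n (avg z fun y => f (u ++ (x ++ y)))]
  refine avg_congr fun x' hx' => avg_congr fun y hy => ?_
  congr 1
  rw [setBlock, e, List.take_append_of_le_length (by omega), List.take_of_length_le (by omega),
    ← List.append_assoc u x' y, List.drop_append, List.drop_of_length_le (by simp; omega)]
  simp [hu, hx']

/-- The blocks of a random string are independent and uniformly distributed. -/
theorem avg_prod_block (n t z : ℕ) (f : List Bool → ℝ) :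
    avg (n * t + z) (fun w => ∏ i ∈ Finset.range t, f (block n i w)) = avg n f ^ t := by
  induction t with
  | zero => simp
  | succ t ih =>
    rw [show n * (t + 1) + z = n + (n * t + z) by ring, avg_append, pow_succ, ← ih,
      ← avg_mul_left]
    refine avg_congr fun x hx => ?_
    rw [← avg_mul_right]
    refine avg_congr fun w hw => ?_
    rw [Finset.prod_range_succ', mul_comm, mul_comm _ (f x)]
    congr 1
    · congr 1
      simp [block, hx]
    · refine Finset.prod_congr rfl fun i _ => ?_
      congr 1
      rw [block, block, add_mul, one_mul, add_comm, ← List.drop_drop]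
      simp [← hx]

/-- Disjoint segments of a random string are independent and uniformly distributed. -/
theorem avg_take_drop {m k L : ℕ} (h : m + k ≤ L) (f : List Bool → List Bool → ℝ) :
    avg L (fun u => f (u.take m) ((u.drop m).take k)) = avg m fun x => avg k fun y => f x y := by
  obtain ⟨z, rfl⟩ := Nat.exists_eq_add_of_le h
  rw [add_assoc, avg_append]
  refine avg_congr fun x hx => ?_
  rw [avg_append]
  refine avg_congr fun y hy => ?_
  rw [← avg_const z (f x y)]
  refine avg_congr fun u hu => ?_
  simp [← hx, ← hy]

theorem encodeBlock_append_inj {y z u v : List Bool}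
    (h : encodeBlock y ++ u = encodeBlock z ++ v) : y = z ∧ u = v := by
  induction y generalizing z with
  | nil => cases z with
    | nil => simpa [encodeBlock] using h
    | cons b z => simp [encodeBlock] at h
  | cons a y ih => cases z with
    | nil => simp [encodeBlock] at h
    | cons b z =>
      simp only [encodeBlock, List.flatMap_cons, List.append_assoc, List.cons_append,
        List.nil_append, List.cons.injEq, true_and] at h
      have := ih (z := z) (by simpa [encodeBlock] using h.2)
      simp [h.1, this]

/-- Tuples of the same length are determined by their codes, whatever is appended. -/
theorem encodeTuple_append_inj {ys zs : List (List Bool)} {u v : List Bool}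
    (hl : ys.length = zs.length) (h : encodeTuple ys ++ u = encodeTuple zs ++ v) : ys = zs := by
  induction ys generalizing zs with
  | nil => simpa using hl.symm
  | cons y ys ih => cases zs with
    | nil => simp at hl
    | cons z zs =>
      simp only [encodeTuple, List.flatMap_cons, List.append_assoc] at h
      have h1 := encodeBlock_append_inj h
      rw [h1.1, ih (by simpa using hl) h1.2]

variable {F : List Bool → List Bool} {τ : ℕ → ℕ}

theorem directPower_eq {w : List Bool} {n : ℕ} (hn : blockLength τ w.length = n) :
    directPower F τ w = encodeTuple ((List.range (τ n)).map fun i => F (block n i w)) ++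
      w.drop (n * τ n) := by
  rw [directPower]
  simp only [hn, powerBlocks]
  congr 2
  refine List.map_congr_left fun i hi => ?_
  have h2 : (i + 1) * n ≤ τ n * n := Nat.mul_le_mul_right _ (by simpa using hi)
  have e : (i + 1) * n = i * n + n := by ring
  rw [block, List.drop_take, List.take_take, mul_comm n]
  congr 2
  omega

theorem blockLength_mul_le (τ : ℕ → ℕ) (N : ℕ) : blockLength τ N * τ (blockLength τ N) ≤ N :=
  Nat.findGreatest_spec (P := fun n => n * τ n ≤ N) (Nat.zero_le N) (by simp)

theorem directPower_setBlock {w x : List Bool} {n i : ℕ} (hn : blockLength τ w.length = n)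
    (hi : i < τ n) (hx : x.length = n) : directPower F τ (setBlock n i w x) =
      blocksWith F n (τ n) i (F x) w ++ w.drop (n * τ n) := by
  have h1 : (i + 1) * n ≤ n * τ n := by rw [mul_comm n]; exact Nat.mul_le_mul_right n hi
  have h2 : n * τ n ≤ w.length := by rw [← hn]; exact blockLength_mul_le τ _
  have h3 := h1.trans h2
  rw [directPower_eq (by rw [length_setBlock h3 hx, hn]), drop_setBlock h3 hx h1, encodeTuple,
    List.flatMap_map, blocksWith]
  congr 1
  refine List.flatMap_congr fun j hj => ?_
  split_ifs with h
  · rw [h, block_setBlock_self h3 hx]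
  · rw [block_setBlock_of_ne h3 hx h]; rfl

theorem block_of_directPower_eq {w x : List Bool} {n i : ℕ} (hl : x.length = w.length)
    (hn : blockLength τ w.length = n) (hi : i < τ n) (h : directPower F τ x = directPower F τ w) :
    F (block n i x) = F (block n i w) := by
  rw [directPower_eq hn, directPower_eq (hl ▸ hn)] at h
  have := encodeTuple_append_inj (by simp) h
  rw [List.map_inj_left] at this
  exact this i (by simpa using hi)

end Blocks

section Estimate

variable {F : List Bool → List Bool} {τ : ℕ → ℕ} {A : PPT} {T M L K : Polynomial ℕ}

/-- With the random bits `r`, the adversary `A` inverts `F` at `F w`. -/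
def Inverts (F : List Bool → List Bool) (A : PPT) (w r : List Bool) : Prop :=
  (A.G (w.length, F w, r)).map (aux F) = some (w.length, F w)

/-- Self-delimiting codes can be decoded, so that an inversion of the direct power at an input with
`i`-th block `x` yields a preimage of `F x`. -/
theorem isPreimage_candidate {x r : List Bool} {n N i j : ℕ} (hn : blockLength τ N = n)
    (hT : T.eval n = τ n) (hi : i < τ n) (hx : x.length = n)
    (hl : N ≤ (r.drop (j * L.eval n)).length)
    (h : Inverts (directPower F τ) A (setBlock n i ((r.drop (j * L.eval n)).take N) x)
      (((r.drop (j * L.eval n)).drop N).take (A.q.eval N))) :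
    IsPreimage F (n, F x, r) (candidate F A T L (n, F x, r) j N i) := by
  have hw : ((r.drop (j * L.eval n)).take N).length = N := by
    rw [List.length_take, min_eq_left hl]
  unfold candidate
  dsimp only
  generalize (r.drop (j * L.eval n)).take N = w at h hw ⊢
  generalize ((r.drop (j * L.eval n)).drop N).take (A.q.eval N) = s at h ⊢
  subst hw
  have h1 : (i + 1) * n ≤ n * τ n := by rw [mul_comm n]; exact Nat.mul_le_mul_right n hi
  have h2 : n * τ n ≤ w.length := by rw [← hn]; exact blockLength_mul_le τ _
  have h3 := h1.trans h2
  have hls := length_setBlock h3 hx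
  rw [Inverts, hls, Option.map_eq_some_iff] at h
  obtain ⟨x', hx', e⟩ := h
  simp only [aux, Prod.mk.injEq] at e
  have hb := block_of_directPower_eq (n := n) (i := i) (e.1.trans hls.symm) (hls ▸ hn) hi e.2
  rw [block_setBlock_self h3 hx] at hb
  rw [directPower_setBlock hn hi hx, ← hT] at hx'
  rw [hx']
  have : ((encodePartial (some x')).drop (1 + i * n)).take n = block n i x' := by
    simp [encodePartial, block, add_comm 1]
  rw [this]
  exact ⟨length_block (by omega), hb⟩

/-- The pointwise form of `invertProb_le`: either some `p i` holds, or none does. -/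
theorem le_sum_mul_add_prod {t : ℕ} {p : ℕ → Prop} {a : ℝ} (h0 : 0 ≤ a) (h1 : a ≤ 1) :
    a ≤ ∑ i ∈ Finset.range t, ind (p i) * a + ∏ i ∈ Finset.range t, (1 - ind (p i)) := by
  have hs : ∀ i ∈ Finset.range t, 0 ≤ ind (p i) * a := fun i _ => mul_nonneg (ind_nonneg _) h0
  by_cases h : ∃ i ∈ Finset.range t, p i
  · obtain ⟨i, hi, hp⟩ := h
    have e1 := Finset.single_le_sum hs hi
    have e2 : 0 ≤ ∏ i ∈ Finset.range t, (1 - ind (p i)) :=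
      Finset.prod_nonneg fun i _ => sub_nonneg.2 (ind_le_one _)
    rw [ind_of hp] at e1
    linarith
  · push Not at h
    have e1 : ∏ i ∈ Finset.range t, (1 - ind (p i)) = 1 :=
      Finset.prod_eq_one fun i hi => by rw [ind_of_not (h i hi), sub_zero]
    have e2 := Finset.sum_nonneg hs
    linarith

theorem one_sub_prod_le {t : ℕ} {p : ℕ → Prop} {q : Prop} (h : ∀ i < t, p i → q) :
    1 - ∏ i ∈ Finset.range t, (1 - ind (p i)) ≤ ind q := by
  by_cases hq : q
  · rw [ind_of hq, sub_le_self_iff]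
    exact Finset.prod_nonneg fun i _ => sub_nonneg.2 (ind_le_one _)
  · rw [ind_of_not hq, Finset.prod_eq_one fun i hi => ?_, sub_self]
    rw [ind_of_not fun hp => hq (h i (Finset.mem_range.1 hi) hp), sub_zero]

/-- The probability, over the random bits of `A`, that `A` inverts `F` at `F w`. -/
noncomputable def successProb (F : List Bool → List Bool) (A : PPT) (w : List Bool) : ℝ :=
  avg (A.q.eval w.length) fun s => ind (Inverts F A w s)

/-- The probability that `A` inverts `F` at `F w` for a random `w` of length `N` whose `i`-th block
of length `n` is `x`. -/
noncomputable def blockSuccessProb (F : List Bool → List Bool) (A : PPT) (n N i : ℕ)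
    (x : List Bool) : ℝ :=
  avg N fun w => successProb F A (setBlock n i w x)

/-- A successful run of `A` has a block at which `A` succeeds with probability at most `c`, or has
no such block. -/
theorem invertProb_le (F : List Bool → List Bool) (A : PPT) {n N t : ℕ} (hN : n * t ≤ N)
    {c : ℝ} (hc : 0 ≤ c) :
    invertProb F A N ≤ t * c +
      (1 - avg n fun x => ind (∀ i < t, blockSuccessProb F A n N i x ≤ c)) ^ t := by
  set φ : List Bool → Prop := fun x => ∀ i < t, blockSuccessProb F A n N i x ≤ c with hφ
  have h0 : ∀ w, 0 ≤ successProb F A w := fun w => avg_nonneg fun _ => ind_nonneg _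
  have h1 : ∀ w, successProb F A w ≤ 1 := fun w => avg_le_one fun _ => ind_le_one _
  have hP : invertProb F A N = avg N (successProb F A) := by
    rw [invertProb_eq_avg]
    refine avg_congr fun w hw => ?_
    rw [successProb, hw]
    simp only [Inverts, hw]
  have hsum : ∀ i ∈ Finset.range t,
      avg N (fun w => ind (φ (block n i w)) * successProb F A w) ≤ c := by
    intro i hi
    have hi := Finset.mem_range.1 hi
    have h3 : (i + 1) * n ≤ N := (Nat.mul_le_mul_right n hi).trans (by rwa [mul_comm])
    rw [avg_block_setBlock hi hN]
    rw [← avg_const n c]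
    refine avg_mono fun x hx => ?_
    have : avg N (fun w => ind (φ (block n i (setBlock n i w x))) *
        successProb F A (setBlock n i w x)) = ind (φ x) * blockSuccessProb F A n N i x := by
      rw [blockSuccessProb, ← avg_mul_left]
      refine avg_congr fun w hw => ?_
      rw [block_setBlock_self (by omega) hx]
    rw [this]
    by_cases hx' : φ x
    · rw [ind_of hx', one_mul]; exact hx' i hi
    · rw [ind_of_not hx', zero_mul]; exact hc
  obtain ⟨z, rfl⟩ := Nat.exists_eq_add_of_le hN
  calc invertProb F A (n * t + z) ≤ avg (n * t + z) (fun w =>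
        ∑ i ∈ Finset.range t, ind (φ (block n i w)) * successProb F A w +
          ∏ i ∈ Finset.range t, (1 - ind (φ (block n i w)))) :=
      hP ▸ avg_mono fun w _ => le_sum_mul_add_prod (h0 w) (h1 w)
    _ = ∑ i ∈ Finset.range t, avg (n * t + z) (fun w => ind (φ (block n i w)) *
          successProb F A w) + (1 - avg n fun x => ind (φ x)) ^ t := by
      rw [avg_add, avg_sum, avg_prod_block n t z fun x => 1 - ind (φ x), avg_one_sub]
    _ ≤ _ := by
      gcongr
      refine (Finset.sum_le_sum hsum).trans ?_
      simp

/-- A lower bound for the probability that the adversary `B` finds a preimage of `F x`, from the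
independent trials with a fixed length `N` and position `i`. -/
theorem le_invertProb {B : PPT} (hBq : B.q = K * L)
    (hB : ∀ a, B.G a = (preimages F A T M L K a).head?) {n N : ℕ} (hn : blockLength τ N = n)
    (hT : T.eval n = τ n) (hM : N < M.eval n) (hL : N + A.q.eval N ≤ L.eval n) {i : ℕ}
    (hi : i < τ n) {x : List Bool} (hx : x.length = n) :
    1 - (1 - blockSuccessProb (directPower F τ) A n N i x) ^ K.eval n ≤
      avg (B.q.eval n) fun r => ind ((B.G (n, F x, r)).map (aux F) = some (n, F x)) := by
  -- `ψ` is the success of a trial as an event on the chunk.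
  set ψ : List Bool → Prop := fun u => Inverts (directPower F τ) A
    (setBlock n i (u.take N) x) ((u.drop N).take (A.q.eval N)) with hψ
  have h3 : (i + 1) * n ≤ N := by
    refine (Nat.mul_le_mul_right n hi).trans ?_
    rw [mul_comm, ← hn]
    exact blockLength_mul_le τ N
  have hg : avg (L.eval n) (fun u => ind (ψ u)) =
      blockSuccessProb (directPower F τ) A n N i x := by
    rw [hψ, avg_take_drop hL fun w s => ind (Inverts (directPower F τ) A (setBlock n i w x) s)]
    refine avg_congr fun w hw => ?_
    rw [successProb, length_setBlock (by omega) hx, hw]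
  have hq : B.q.eval n = L.eval n * K.eval n + 0 := by rw [hBq]; simp [mul_comm]
  rw [← hg, ← avg_one_sub, ← avg_prod_block (L.eval n) (K.eval n) 0 fun u => 1 - ind (ψ u),
    ← avg_one_sub, hq]
  refine avg_mono fun r hr => one_sub_prod_le fun j hj hp => ?_
  have hlen : L.eval n ≤ (r.drop (j * L.eval n)).length := by
    have : (j + 1) * L.eval n ≤ K.eval n * L.eval n := Nat.mul_le_mul_right _ hj
    have e : (j + 1) * L.eval n = j * L.eval n + L.eval n := by ring
    rw [List.length_drop, hr, mul_comm (L.eval n), add_zero]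
    omega
  have hmem : candidate F A T L (n, F x, r) j N i ∈ preimages F A T M L K (n, F x, r) := by
    refine mem_preimages.2 ⟨isPreimage_candidate hn hT hi hx (by omega) ?_, j, hj, N, hM, i,
      hT ▸ hi, rfl⟩
    have e1 : ((r.drop (j * L.eval n)).take (L.eval n)).take N =
        (r.drop (j * L.eval n)).take N := by
      rw [List.take_take, min_eq_left (by omega)]
    have e2 : (((r.drop (j * L.eval n)).take (L.eval n)).drop N).take (A.q.eval N) =
        ((r.drop (j * L.eval n)).drop N).take (A.q.eval N) := by
      rw [List.drop_take, List.take_take, min_eq_left (by omega)]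
    simpa only [hψ, block, e1, e2] using hp
  rw [hB]
  cases hl : preimages F A T M L K (n, F x, r) with
  | nil => rw [hl] at hmem; simp at hmem
  | cons y l =>
    have hy : y ∈ preimages F A T M L K (n, F x, r) := by simp [hl]
    have := (mem_preimages.1 hy).1
    simp [aux, this.1, this.2]

/-- The reduction for a fixed `n`: here `β` is the fraction of the strings `x` on which `A` succeeds
with probability at most `ε / (2t)`, at whatever position `x` is placed. -/
theorem exists_badFraction {B : PPT} (hBq : B.q = K * L)
    (hB : ∀ a, B.G a = (preimages F A T M L K a).head?) {n N : ℕ} (hn : blockLength τ N = n)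
    (hT : T.eval n = τ n) (ht : 0 < τ n) (hM : N < M.eval n) (hL : N + A.q.eval N ≤ L.eval n)
    {ε : ℝ} (h0 : 0 < ε) (hε : ε < invertProb (directPower F τ) A N) :
    ∃ β : ℝ, β ≤ 1 ∧ ε / 2 < (1 - β) ^ τ n ∧
      1 - β - (1 - ε / (2 * τ n)) ^ K.eval n ≤ invertProb F B n := by
  have ht' : (0 : ℝ) < τ n := by exact_mod_cast ht
  have h1 := invertProb_le (directPower F τ) A (n := n) (N := N) (t := τ n)
    (by rw [← hn]; exact blockLength_mul_le τ N) (c := ε / (2 * τ n)) (by positivity)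
  refine ⟨avg n fun x => ind (∀ i < τ n,
    blockSuccessProb (directPower F τ) A n N i x ≤ ε / (2 * τ n)), avg_le_one fun x =>
    ind_le_one _, ?_, ?_⟩
  · have : τ n * (ε / (2 * τ n)) = ε / 2 := by field_simp
    linarith
  have hβ : ∀ b δ : ℝ, 0 ≤ b → 0 ≤ δ → 1 - b - δ ≤ (1 - b) * (1 - δ) := fun b δ hb hδ => by
    nlinarith [mul_nonneg hb hδ]
  have hg1 : ∀ i x, blockSuccessProb (directPower F τ) A n N i x ≤ 1 := fun i x =>
    avg_le_one fun _ => avg_le_one fun _ => ind_le_one _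
  have hP : invertProb (directPower F τ) A N ≤ 1 := by
    rw [invertProb_eq_avg]
    exact avg_le_one fun _ => avg_le_one fun _ => ind_le_one _
  have hδ : 0 ≤ (1 - ε / (2 * τ n)) ^ K.eval n := by
    have h1t : (1 : ℝ) ≤ τ n := by exact_mod_cast ht
    refine pow_nonneg (sub_nonneg.2 ((div_le_one (by positivity)).2 ?_)) _
    linarith
  refine (hβ _ _ (avg_nonneg fun _ => ind_nonneg _) hδ).trans ?_
  rw [← avg_one_sub, ← avg_mul_right, invertProb_eq_avg]
  refine avg_mono fun x hx => ?_
  by_cases h : ∀ i < τ n, blockSuccessProb (directPower F τ) A n N i x ≤ ε / (2 * τ n)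
  · rw [ind_of h, sub_self, zero_mul]
    exact avg_nonneg fun _ => ind_nonneg _
  · rw [ind_of_not h, sub_zero, one_mul]
    push Not at h
    obtain ⟨i, hi, h⟩ := h
    refine le_trans ?_ (le_invertProb hBq hB hn hT hM hL hi hx)
    gcongr
    exact sub_nonneg.2 (hg1 i x)

end Estimate

/-! ### Asymptotics -/

open Filter Topology

theorem tendsto_blockLength {τ : ℕ → ℕ} (hτ : Monotone τ) :
    Tendsto (blockLength τ) atTop atTop := by
  refine tendsto_atTop.2 fun b => ?_
  filter_upwards [eventually_ge_atTop (b * τ b), eventually_ge_atTop b] with N hN hb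
  exact (le_blockLength_iff hτ hb).2 hN

theorem lt_blockLength_add_one {k N : ℕ} :
    N < (blockLength (fun n => n ^ k) N + 1) ^ (k + 1) := by
  set n := blockLength (fun n => n ^ k) N with hn
  by_contra! h
  have h1 : n + 1 ≤ N := (Nat.le_self_pow (by omega) _).trans h
  have := (le_blockLength_iff (t := fun n => n ^ k) (fun a b h => Nat.pow_le_pow_left h k) h1).2
    (by rwa [← pow_succ'])
  omega

theorem eventually_exp_neg_lt_div_pow {a C : ℝ} (ha : 0 < a) (hC : 0 < C) (b : ℝ) (k : ℕ) :
    ∀ᶠ n : ℕ in atTop, Real.exp (-(a * n)) < C / ((n : ℝ) + b) ^ k := by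
  have h1 : Tendsto (fun n : ℕ => a * ((n : ℝ) + b)) atTop atTop :=
    (tendsto_atTop_add_const_right _ b tendsto_natCast_atTop_atTop).const_mul_atTop ha
  filter_upwards [((Real.tendsto_pow_mul_exp_neg_atTop_nhds_zero k).comp h1).eventually_lt_const
    (show 0 < C * a ^ k * Real.exp (-(a * b)) by positivity), h1.eventually_gt_atTop 0]
    with n hn h0
  have h2 : 0 < (n : ℝ) + b := pos_of_mul_pos_right h0 ha.le
  rw [lt_div_iff₀ (by positivity)]
  have h3 : Real.exp (-(a * ((n : ℝ) + b))) = Real.exp (-(a * n)) * Real.exp (-(a * b)) := by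
    rw [← Real.exp_add]; ring_nf
  simp only [Function.comp, h3, mul_pow] at hn
  refine lt_of_mul_lt_mul_right (a := a ^ k * Real.exp (-(a * b))) ?_ (by positivity)
  linarith

theorem one_sub_pow_le_exp {x : ℝ} (hx : x ≤ 1) (n : ℕ) : (1 - x) ^ n ≤ Real.exp (-(n * x)) := by
  have h := Real.add_one_le_exp (-x)
  calc (1 - x) ^ n ≤ Real.exp (-x) ^ n := by
        gcongr
        linarith
    _ = Real.exp (-(n * x)) := by rw [← Real.exp_nat_mul]; ring_nf

/-- If `A` exceeded `N ^ (-d)` at a large `N`, the adversary obtained from it would break the weak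
one-wayness of `F` at the block length of `N`. -/
theorem negligible_invertProb_directPower {F : List Bool → List Bool} {c : ℕ}
    (hF : WeaklyOneWayWith c F) (A : PPT) :
    Negligible (invertProb (directPower F fun n => n ^ (c + 1)) A) := by
  intro d hd
  set τ : ℕ → ℕ := fun n => n ^ (c + 1) with hτ
  have hmono : Monotone τ := fun a b h => Nat.pow_le_pow_left h _
  obtain ⟨D, hD⟩ := exists_nat_ge d
  -- `M n` exceeds every `N` with block length `n`; so `ε := M n ^ (-D)` is at most `N ^ (-d)`, and
  -- `K n` trials that succeed with probability `ε / (2t)` all fail with probability `exp (-n)` at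
  -- most.
  set T : Polynomial ℕ := .X ^ (c + 1)
  set M : Polynomial ℕ := (.X + 1) ^ (c + 2)
  set L : Polynomial ℕ := M + A.q.comp M
  set K : Polynomial ℕ := 2 * T * M ^ D * .X
  obtain ⟨B, hBq, hB⟩ := exists_ppt A T M L K hF.1 (K * L)
  have e1 : ∀ᶠ n : ℕ in atTop, invertProb F B n ≤ 1 - 1 / (n : ℝ) ^ c ∧ 0 < n ∧
      Real.exp (-(1 / 2 * n)) < (1 / 2) / ((n : ℝ) + 1) ^ ((c + 2) * D) ∧
      Real.exp (-(1 * n)) < (1 / 2) / ((n : ℝ) + 0) ^ c :=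
    (hF.2 B).and ((eventually_gt_atTop 0).and
        ((eventually_exp_neg_lt_div_pow (by norm_num) (by norm_num) _ _).and
      (eventually_exp_neg_lt_div_pow (by norm_num) (by norm_num) _ _)))
  filter_upwards [(tendsto_blockLength hmono).eventually e1,
    eventually_gt_atTop 0] with N ⟨h1, h2, h3, h4⟩ hN
  set n := blockLength τ N with hn
  by_contra! hlt
  have hM : M.eval n = (n + 1) ^ (c + 2) := by simp [M]
  have hT : T.eval n = τ n := by simp [T, hτ]
  have hNM : N < M.eval n := hM ▸ lt_blockLength_add_one
  have hL : N + A.q.eval N ≤ L.eval n := by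
    simp only [L, Polynomial.eval_add, Polynomial.eval_comp]
    exact add_le_add hNM.le (eval_mono _ hNM.le)
  set ε : ℝ := ((M.eval n : ℕ) : ℝ)⁻¹ ^ D with hε
  have hNR : (1 : ℝ) ≤ N := by exact_mod_cast hN
  have hNMR : (N : ℝ) ≤ (M.eval n : ℕ) := by exact_mod_cast hNM.le
  have hM0 : (0 : ℝ) < (M.eval n : ℕ) := by linarith
  have hε0 : 0 < ε := by positivity
  have hεlt : ε < invertProb (directPower F τ) A N := by
    refine lt_of_le_of_lt ?_ hlt
    rw [hε, inv_pow, Real.rpow_neg (by linarith)]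
    gcongr
    calc (N : ℝ) ^ d ≤ (N : ℝ) ^ (D : ℝ) := Real.rpow_le_rpow_of_exponent_le hNR hD
      _ = (N : ℝ) ^ D := Real.rpow_natCast _ _
      _ ≤ _ := by gcongr
  have hτ0 : 0 < τ n := pow_pos h2 _
  obtain ⟨β, hβ1, hβ2, hβ3⟩ := exists_badFraction hBq hB hn.symm hT hτ0 hNM hL hε0 hεlt
  have hnR : (0 : ℝ) < n := by exact_mod_cast h2
  have hτR : (τ n : ℝ) = (n : ℝ) ^ c * n := by simp [hτ, pow_succ]
  -- Otherwise `(1 - β) ^ t ≤ exp (-n / 2)`, which is less than `ε / 2`.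
  have hβ : β < (1 / 2) / (n : ℝ) ^ c := by
    by_contra! hge
    have h5 := one_sub_pow_le_exp hβ1 (τ n)
    have h6 : Real.exp (-(τ n * β)) ≤ Real.exp (-(1 / 2 * n)) := by
      rw [Real.exp_le_exp, neg_le_neg_iff, hτR]
      calc 1 / 2 * (n : ℝ) = (n : ℝ) ^ c * n * ((1 / 2) / (n : ℝ) ^ c) := by field_simp
        _ ≤ _ := by gcongr
    have h7 : ε / 2 = (1 / 2) / ((n : ℝ) + 1) ^ ((c + 2) * D) := by
      rw [hε, hM, pow_mul]
      push_cast
      rw [inv_pow]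
      field_simp
    linarith
  have hx : ε / (2 * τ n) ≤ 1 := by
    have h1t : (1 : ℝ) ≤ τ n := by exact_mod_cast hτ0
    have hε1 : ε ≤ 1 := pow_le_one₀ (by positivity) (inv_le_one_of_one_le₀ (by linarith))
    rw [div_le_one (by positivity)]
    linarith
  have h8 := one_sub_pow_le_exp hx (K.eval n)
  have h9 : ((K.eval n : ℕ) : ℝ) * (ε / (2 * τ n)) = 1 * n := by
    have : K.eval n = 2 * τ n * M.eval n ^ D * n := by simp [K, hT]
    rw [this, hε, inv_pow]
    push_cast
    field_simp
  rw [h9] at h8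
  rw [add_zero] at h4
  have h10 : 1 / (n : ℝ) ^ c = (1 / 2) / (n : ℝ) ^ c + (1 / 2) / (n : ℝ) ^ c := by ring
  linarith

end OneWay

theorem mainTheorem4 (F : List Bool → List Bool) (c : ℕ) (hc : 0 < c)
    (hF : OneWay.WeaklyOneWayWith c F) :
    OneWay.StronglyOneWay (OneWay.directPower F fun n => n ^ (c + 1)) :=
  ⟨hF.1.directPower (c + 1), OneWay.negligible_invertProb_directPower hF⟩
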